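/- **Setting.** A sandpile $S$ is a finite multigraph with vertex set $V_h\cup\{s\}$, where $s$ is the sink, the set $V_h$ of ordinary sites is connected, there are no loops, and at least one site is joined to $s$. Write $\deg(v)$ for the number of edges at $v$ (edges to $s$ included) and $|S|=|V_h|+1$ for the number of vertices. A configuration is a map $c:V_h\to\mathbb N$; a site $v$ with $c(v)\ge\deg(v)$ is unstable and may topple, sending one particle along each of its edges (particles sent to $s$ disappear). A configuration $c$ *floods* (*topples*) a site $w$ if some sequence of legal topplings from $c$ leads to a configuration in which $w$ holds at least one particle (at least $\deg(w)$ particles). A configuration $c$ is recurrent if for every configuration $c'$ there is $c''\ge c'$ from which legal topplings lead to $c$. The transience class $\mathrm{tcl}(S)$ is the maximum number of particles that can be added one at a time, at arbitrary sites, starting from the empty configuration and relaxing after each addition, such that the configuration is still not recurrent. Let $B(v,r)$ be the ball in the shortest-path metric, $\mathrm{Vol}(B(v,r))$ the number of edges with both ends in it, and $\eta(v)$ the distance from $v$ to the set of sites adjacent to $s$; the balls inside $S$ are those with $r\le\eta(v)$. **Properties** of a family $\mathcal S=(S_i)$ of sandpiles, with constants independent of $i$; radii are integers $\ge 1$ and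 balls lie inside $S_i$. * $(\Delta)$: every ordinary site has degree at most $\Delta$. * $\mathrm{hLC}(C_\sigma)$: for every ball $B(v,r)$, some number $N\le C_\sigma\mathrm{Vol}(B(v,r))$ of particles placed at $v$ floods every site of $B(v,r)$. * $\mathrm{OP}(f)$, where $f:\mathbb R\to\mathbb R$: for all balls $B(v,r)$, $B(v,R)$ the least $h$ such that $h$ particles on each site of $B(v,r)$ topple every site of $B(v,R)$ is at most $f(R/r)$. * $\mathrm{NI}(k,l)$ with slope bound $\beta\in(0,1]$, where $k\in\mathbb N$ and $l\ge0$: any two sites of $S_i$ are joined by a path in $V_h$ that is a juxtaposition of at most $k$ paths $P$, each of which either has length at most $l\log|S_i|$ or is such that $\eta$ varies linearly on it: for some reals $a_l,a_u,b$ with $|a_l|,|a_u|\le1$ and $\beta\le|b|\le1$, the $j$-th vertex $v_j$ of $P=(v_0,v_1,\dots)$ satisfies $a_l+\eta(v_0)+bj\le\eta(v_j)\le a_u+\eta(v_0)+bj$ for all $j$. * $\mathrm{MV}(C_h)$: for every $\pi:V_h\cup\{s\}\to[0,1]$ harmonic over a set $U\subseteq V_h$ and every ball $B(v,r)\subseteq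 U$, $\sum_{u\in B(v,r)}\pi(u)\ge C_h\,\pi(v)\,\mathrm{Vol}(B(v,r))$. * $V_\alpha$: $\delta r^\alpha\le\mathrm{Vol}(B(v,r))\le\Delta r^\alpha$ for every ball. **Theorem (Epicenter Propagation).** Let $\mathcal S$ satisfy $(\Delta)$, $\mathrm{hLC}(C_\sigma)$, $\mathrm{OP}(f)$ and $\mathrm{NI}(k,l)$ with slope bound $\beta$. Then there is a polynomial $P$ such that, for every $i$ and every site $u$ of $S_i$, some number $N\le P(|S_i|)$ of particles added at $u$ topples every site of $S_i$. If moreover $\mathcal S$ satisfies $\mathrm{MV}(C_h)$ and $V_\alpha$ with constants $\delta$ and the same $\Delta$, where $0<C_h\le1\le C_\sigma$, $0<\delta\le\Delta$ and $\alpha\ge0$, then for every $i$, with $n=|S_i|$, $$\mathrm{tcl}(S_i)\le C_\sigma\,\Delta\; n^{\,k+(2l+1)k\,\log_{\hat g}\left(\frac{C_\sigma}{C_h}\cdot\frac{\Delta(\Delta+1)}{\delta}\cdot3^\alpha\right)},\qquad \hat g=\min\left\{1+\tfrac{\beta}{2},\ \left(1-\tfrac{\beta}{2}\right)^{-1}\right\}.$$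 -/

import Mathlib

/-- An abelian sandpile: a finite multigraph on the ordinary sites `V` together with a sink.
`mult u v` is the number of edges between the ordinary sites `u` and `v`, and `sinkMult v` the
number of edges between `v` and the sink.  The ordinary sites form a connected set, and at least
one of them is joined to the sink. (This is the sandpile induced by a connected vertex set of an
ambient graph, all outside vertices being identified with the sink.) -/
structure Sandpile (V : Type*) where
  mult : V → V → ℕ
  mult_symm : ∀ u v, mult u v = mult v u
  mult_self : ∀ v, mult v v = 0
  sinkMult : V → ℕ
  connected : (SimpleGraph.fromRel fun u v => 0 < mult u v).Connected
  exists_sink : ∃ v, 0 < sinkMult v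

namespace Sandpile

noncomputable section

variable {V : Type*} [Fintype V] [DecidableEq V]

/-- The adjacency graph on the ordinary sites. -/
def graph (S : Sandpile V) : SimpleGraph V := SimpleGraph.fromRel fun u v => 0 < S.mult u v

/-- Degree of an ordinary site, counting multiplicities and the edges to the sink. -/
def deg (S : Sandpile V) (v : V) : ℕ := ∑ w, S.mult v w + S.sinkMult v

/-- `|S|`, the number of vertices of the sandpile graph, the sink included. -/
def size (_S : Sandpile V) : ℕ := Fintype.card V + 1

/-! ### Dynamics -/

/-- The result of toppling `v` in the configuration `c`. -/
def topple (S : Sandpile V) (c : V → ℕ) (v : V) : V → ℕ :=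
  fun w => if w = v then c v - S.deg v else c w + S.mult v w

/-- One legal toppling: an unstable site topples. -/
def Step (S : Sandpile V) (c c' : V → ℕ) : Prop :=
  ∃ v, S.deg v ≤ c v ∧ c' = S.topple c v

/-- `c ⊢ c'`: a sequence of legal topplings leads from `c` to `c'`. -/
def Leads (S : Sandpile V) : (V → ℕ) → (V → ℕ) → Prop := Relation.ReflTransGen S.Step

def Stable (S : Sandpile V) (c : V → ℕ) : Prop := ∀ v, c v < S.deg v

/-- `c` is recurrent: from every configuration one can add particles and topple to reach `c`. -/
def Recurrent (S : Sandpile V) (c : V → ℕ) : Prop :=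
  ∀ c' : V → ℕ, ∃ c'' : V → ℕ, c' ≤ c'' ∧ S.Leads c'' c

/-- `S.Evolves N s`: starting from the empty configuration, adding `N` particles one at a time at
sites of our choice and relaxing after each addition, one can obtain the configuration `s`. -/
inductive Evolves (S : Sandpile V) : ℕ → (V → ℕ) → Prop
  | empty : Evolves S 0 0
  | add {N : ℕ} {s s' : V → ℕ} (v : V) : Evolves S N s →
      S.Leads (s + Pi.single v 1) s' → S.Stable s' → Evolves S (N + 1) s'

/-- The numbers of particles that can be added while the sandpile stays transient. -/
def transientCounts (S : Sandpile V) : Set ℕ := {N | ∃ s, S.Evolves N s ∧ ¬ S.Recurrent s}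

/-- The transience class. -/
def tcl (S : Sandpile V) : ℕ := sSup S.transientCounts

/-- Starting from `c`, the site `w` holds a particle at some time (it is flooded). -/
def Floods (S : Sandpile V) (c : V → ℕ) (w : V) : Prop := ∃ c', S.Leads c c' ∧ 1 ≤ c' w

/-- Starting from `c`, the site `w` becomes unstable, hence can topple, at some time. -/
def Topples (S : Sandpile V) (c : V → ℕ) (w : V) : Prop := ∃ c', S.Leads c c' ∧ S.deg w ≤ c' w

/-! ### Geometry -/

def ball (S : Sandpile V) (v : V) (r : ℕ) : Finset V :=
  Finset.univ.filter fun w => S.graph.dist v w ≤ r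

/-- The number of edges, with multiplicity, having both ends in the ball. -/
def vol (S : Sandpile V) (v : V) (r : ℕ) : ℝ :=
  (∑ u ∈ S.ball v r, ∑ w ∈ S.ball v r, (S.mult u w : ℝ)) / 2

/-- The distance from `v` to the vertex boundary, that is, to the set of sites adjacent to the
sink.  The ball of radius `r` about `v` lies inside the sandpile (does not reach the sink) exactly
when `r ≤ S.eta v`. -/
def eta (S : Sandpile V) (v : V) : ℕ :=
  sInf {d | ∃ b, 0 < S.sinkMult b ∧ S.graph.dist v b = d}

/-- `p`, with value `ps` at the sink, is harmonic at `v`. -/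
def HarmonicAt (S : Sandpile V) (p : V → ℝ) (ps : ℝ) (v : V) : Prop :=
  (∑ w, (S.mult v w : ℝ) * p w + (S.sinkMult v : ℝ) * ps) / (S.deg v : ℝ) = p v

/-- `eta` varies linearly along the path `P`, with a slope `b` satisfying `β ≤ |b| ≤ 1`. -/
def LinearAlong (S : Sandpile V) (β : ℝ) {v w : V} (P : S.graph.Walk v w) : Prop :=
  ∃ al au b : ℝ, |al| ≤ 1 ∧ |au| ≤ 1 ∧ β ≤ |b| ∧ |b| ≤ 1 ∧
    ∀ j : ℕ, j ≤ P.length →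
      al + (S.eta v : ℝ) + b * (j : ℝ) ≤ (S.eta (P.getVert j) : ℝ) ∧
      (S.eta (P.getVert j) : ℝ) ≤ au + (S.eta v : ℝ) + b * (j : ℝ)

/-- A central piece: `eta` varies linearly along it, or it has length at most `l * log |S|`. -/
def CentralPiece (S : Sandpile V) (β l : ℝ) {v w : V} (P : S.graph.Walk v w) : Prop :=
  S.LinearAlong β P ∨ (P.length : ℝ) ≤ l * Real.log (S.size : ℝ)

/-- `P` is a juxtaposition of `k` central pieces.  Trivial paths are central pieces when `0 ≤ l`,
so this is the same as a juxtaposition of at most `k` pieces. -/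
def IsCentral (S : Sandpile V) (β l : ℝ) : ℕ → ∀ {v w : V}, S.graph.Walk v w → Prop
  | 0, _, _, P => P.length = 0
  | k + 1, v, w, P => ∃ (m : V) (P₁ : S.graph.Walk v m) (P₂ : S.graph.Walk m w),
      P = P₁.append P₂ ∧ S.CentralPiece β l P₁ ∧ IsCentral S β l k P₂

end

end Sandpile

/-! ### Properties of families of sandpiles -/

namespace SandpileFamily

noncomputable section

variable {ι : Type*} {V : ι → Type*} [∀ i, Fintype (V i)] [∀ i, DecidableEq (V i)]

/-- Degree boundedness: all ordinary sites of all members have degree at most `Δ`. -/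
def DegreeBounded (S : ∀ i, Sandpile (V i)) (Δ : ℝ) : Prop :=
  ∀ i (v : V i), ((S i).deg v : ℝ) ≤ Δ

/-- Polynomial volume growth with exponent `α` and constants `δ`, `Δ`, for balls inside the
sandpile. -/
def VolumeGrowth (S : ∀ i, Sandpile (V i)) (α δ Δ : ℝ) : Prop :=
  ∀ i (v : V i) (r : ℕ), 1 ≤ r → r ≤ (S i).eta v →
    δ * (r : ℝ) ^ α ≤ (S i).vol v r ∧ (S i).vol v r ≤ Δ * (r : ℝ) ^ α

/-- High local conductance: at most `Cσ * vol` particles placed at the centre flood the ball. -/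
def HighLocalConductance (S : ∀ i, Sandpile (V i)) (Cσ : ℝ) : Prop :=
  ∀ i (v : V i) (r : ℕ), 1 ≤ r → r ≤ (S i).eta v →
    ∃ N : ℕ, (N : ℝ) ≤ Cσ * (S i).vol v r ∧
      ∀ w ∈ (S i).ball v r, (S i).Floods (Pi.single v N) w

/-- Mean value property: for functions `[0,1]`-valued on all vertices (`ps` is the value at the
sink) that are harmonic over a set `U` of ordinary sites, and balls of the sandpile inside `U`. -/
def MeanValue (S : ∀ i, Sandpile (V i)) (Ch : ℝ) : Prop :=
  ∀ i (U : Set (V i)) (p : V i → ℝ) (ps : ℝ),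
    (∀ u, p u ∈ Set.Icc (0 : ℝ) 1) → ps ∈ Set.Icc (0 : ℝ) 1 →
    (∀ u ∈ U, (S i).HarmonicAt p ps u) →
    ∀ (v : V i) (r : ℕ), 1 ≤ r → r ≤ (S i).eta v → (∀ u ∈ (S i).ball v r, u ∈ U) →
      Ch * p v * (S i).vol v r ≤ ∑ u ∈ (S i).ball v r, p u

/-- Overlapping potentials: the least `h` such that `h` particles at every site of `B(v,r)` make
every site of `B(v,R)` topple is at most `f (R/r)`. -/
def OverlappingPotentials (S : ∀ i, Sandpile (V i)) (f : ℝ → ℝ) : Prop :=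
  ∀ i (v : V i) (r R : ℕ), 1 ≤ r → 1 ≤ R → r ≤ (S i).eta v → R ≤ (S i).eta v →
    ∃ h : ℕ, (h : ℝ) ≤ f ((R : ℝ) / (r : ℝ)) ∧
      ∀ w ∈ (S i).ball v R,
        (S i).Topples (fun u => if u ∈ (S i).ball v r then h else 0) w

/-- Non-empty interior: any two sites are joined by a `(k,l)`-central path, the slopes of the
linear pieces being at least `β` in absolute value. -/
def NonemptyInterior (S : ∀ i, Sandpile (V i)) (k : ℕ) (l β : ℝ) : Prop :=
  ∀ i (v w : V i), ∃ P : (S i).graph.Walk v w, (S i).IsCentral β l k P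

/-- Polynomially bounded transience class: polynomially many particles added at any site make
every site topple. -/
def PolynomialTransience (S : ∀ i, Sandpile (V i)) : Prop :=
  ∃ P : Polynomial ℕ, ∀ i (u : V i), ∃ N : ℕ, N ≤ P.eval (S i).size ∧
    ∀ w, (S i).Topples (Pi.single u N) w

/-- The guaranteed growth or decay ratio per step along a linear piece: the smaller of
`1 + b/2` for `b = β` and `(1 + b/2)⁻¹` for `b = -β`. -/
def gHat (β : ℝ) : ℝ := min (1 + β / 2) (1 - β / 2)⁻¹

end

end SandpileFamily

set_option linter.unusedSectionVars false

namespace Sandpile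

noncomputable section

variable {V : Type*} [Fintype V] [DecidableEq V]

/-! ### The reduced Laplacian and hitting probabilities -/

/-! Both bounds reduce to a lower bound for `S.hit w u`, the probability that the random walk from
`u` hits `w` before the sink. A toppling at `x` lowers the weight `∑ c x * p x` by the Laplacian of
`p` at `x` (`Legal.sum_mul`), and `S.hit w` is harmonic off `w`; so this weight is conserved while
`w` does not topple. A stable configuration weighs at most `(Δ - 1) * |V|`, whereas `N` particles
weigh at least `N * ε` if all hitting probabilities are at least `ε`. Hence too many particles at
one site topple everything (`topples_of_lt`), and too many particles in all make every site topple,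
which forces recurrence (`Legal.recurrent`, `mul_le_of_mem_transientCounts`).

Along a central path the bounds multiply (`hit_mul_hit_le`). A short piece loses at most a factor
`Δ` per step. On a linear piece one hops from ball to ball, with lengths proportional to the
distance to the boundary; that distance changes geometrically, so logarithmically many hops suffice.
The comparison at each hop comes from `sum_le_two_mul_of_floods`, which turns flooding into an upper
bound for the mass of a harmonic function over a ball. With the mean value property and volume
growth this becomes a pointwise Harnack inequality, `hit_le_two_mul_hit`. Without them, overlapping
potentials with radius ratio `4` compare the masses `quarterMass`, and local conductance is needed
only once per piece, to return from a mass to the value at the centre.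

The explicit exponent leaves no slack for constants. If a linear piece uses `t` single steps and `m`
hops, and `T` is `log n` to base `1 + b / 2`, the powers of the Harnack constant are paid for by the
bound on `m`, and the remaining factors `Δ ^ t`, `2 ^ m` and possibly `n` must fit into `(Δ + 1) ^
T`. The numerical lemmas prove this for `Δ ≥ 3` and `n ≥ 7` (for descents with `b < 1 / 2`, `n ≥
9`); the remaining cases are handled by simple paths. -/

/-- The reduced Laplacian: the sink is given the value `0`. -/
def lap (S : Sandpile V) : (V → ℝ) →ₗ[ℝ] (V → ℝ) where
  toFun p x := (S.deg x : ℝ) * p x - ∑ w, (S.mult x w : ℝ) * p w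
  map_add' p q := by
    ext x
    simp only [Pi.add_apply, mul_add, Finset.sum_add_distrib]
    ring
  map_smul' a p := by
    ext x
    simp only [Pi.smul_apply, smul_eq_mul, RingHom.id_apply, mul_sub, Finset.mul_sum]
    congr 1
    · ring
    · exact Finset.sum_congr rfl fun w _ => by ring

theorem lap_apply (S : Sandpile V) (p : V → ℝ) (x : V) :
    S.lap p x = (S.deg x : ℝ) * p x - ∑ w, (S.mult x w : ℝ) * p w := rfl

theorem lap_eq_sum (S : Sandpile V) (p : V → ℝ) (x : V) :
    S.lap p x = ∑ w, (S.mult x w : ℝ) * (p x - p w) + S.sinkMult x * p x := by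
  simp only [lap_apply, deg, mul_sub, Finset.sum_sub_distrib, ← Finset.sum_mul]
  push_cast
  ring

theorem graph_adj (S : Sandpile V) {u v : V} : S.graph.Adj u v ↔ 0 < S.mult u v := by
  unfold graph
  rw [SimpleGraph.fromRel_adj]
  constructor
  · rintro ⟨_, h | h⟩
    · exact h
    · rwa [S.mult_symm]
  · intro h
    refine ⟨?_, Or.inl h⟩
    rintro rfl
    simp [S.mult_self] at h

theorem graph_connected (S : Sandpile V) : S.graph.Connected := S.connected

/-- Minimum principle: a function that is superharmonic wherever it is negative is nonnegative. -/
theorem nonneg_of_lap_nonneg (S : Sandpile V) (φ : V → ℝ)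
    (h : ∀ x, φ x < 0 → 0 ≤ S.lap φ x) (x : V) : 0 ≤ φ x := by
  by_contra hx
  push Not at hx
  have : Nonempty V := ⟨x⟩
  obtain ⟨x₀, hmin⟩ := Finite.exists_min φ
  have hneg : φ x₀ < 0 := (hmin x).trans_lt hx
  -- At a negative minimum every term of the Laplacian is nonpositive while the sum is nonnegative,
  -- so every term vanishes. The minimum therefore spreads along edges to a site joined to the sink,
  -- where the sink term is strictly negative.
  have key : ∀ a, φ a = φ x₀ →
      (∀ w, (S.mult a w : ℝ) * (φ a - φ w) = 0) ∧ (S.sinkMult a : ℝ) * φ a = 0 := by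
    intro a ha
    have h1 := h a (ha ▸ hneg)
    rw [lap_eq_sum] at h1
    have h2 : ∀ w ∈ Finset.univ, (S.mult a w : ℝ) * (φ a - φ w) ≤ 0 := fun w _ =>
      mul_nonpos_of_nonneg_of_nonpos (Nat.cast_nonneg _) (by rw [ha]; linarith [hmin w])
    have h3 : (S.sinkMult a : ℝ) * φ a ≤ 0 :=
      mul_nonpos_of_nonneg_of_nonpos (Nat.cast_nonneg _) (by rw [ha]; exact hneg.le)
    have h4 := Finset.sum_nonpos h2
    refine ⟨fun w => ?_, by linarith⟩
    exact (Finset.sum_eq_zero_iff_of_nonpos h2).1 (by linarith) w (Finset.mem_univ w)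
  have all : ∀ y, φ y = φ x₀ := by
    intro y
    have hr := (SimpleGraph.reachable_iff_reflTransGen x₀ y).1 (S.graph_connected.preconnected x₀ y)
    induction hr with
    | refl => rfl
    | tail _ hadj ih =>
      have h1 := (key _ ih).1
      rename_i b c _
      rcases mul_eq_zero.1 (h1 c) with h2 | h2
      · have := S.graph_adj.1 hadj
        norm_cast at h2
        omega
      · linarith
  obtain ⟨b, hb⟩ := S.exists_sink
  rcases mul_eq_zero.1 (key b (all b)).2 with h1 | h1
  · norm_cast at h1
    omega
  · rw [all b] at h1
    linarith

theorem deg_pos (S : Sandpile V) (v : V) : 0 < S.deg v := by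
  by_contra h
  have h0 : S.deg v = 0 := by omega
  have hz : ∀ w, S.mult v w = 0 := by
    intro w
    have h1 : S.mult v w ≤ ∑ w, S.mult v w :=
      Finset.single_le_sum (f := fun w => S.mult v w) (fun _ _ => Nat.zero_le _) (Finset.mem_univ w)
    unfold deg at h0
    omega
  have := S.nonneg_of_lap_nonneg (fun x => if x = v then -1 else 0) (fun x hx => by
    have hxv : x = v := by
      by_contra hne
      simp [hne] at hx
    subst hxv
    simp [lap_apply, h0, hz]) v
  norm_num at this

theorem one_le_deg (S : Sandpile V) (v : V) : (1 : ℝ) ≤ S.deg v := by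
  exact_mod_cast S.deg_pos v

theorem lap_injective (S : Sandpile V) : Function.Injective S.lap := by
  rw [injective_iff_map_eq_zero]
  intro φ hφ
  ext x
  refine le_antisymm ?_ (S.nonneg_of_lap_nonneg φ (fun x _ => by simp [hφ]) x)
  have := S.nonneg_of_lap_nonneg (-φ) (fun x _ => by simp [hφ]) x
  simpa using this

theorem lap_surjective (S : Sandpile V) : Function.Surjective S.lap :=
  LinearMap.injective_iff_surjective.1 S.lap_injective

/-- There is a nonnegative function with Laplacian `1` (the expected absorption time, up to
normalisation). -/
theorem exists_lap_eq_one (S : Sandpile V) : ∃ φ : V → ℝ, (∀ x, 0 ≤ φ x) ∧ ∀ x, S.lap φ x = 1 := by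
  obtain ⟨φ, hφ⟩ := S.lap_surjective 1
  exact ⟨φ, S.nonneg_of_lap_nonneg φ fun x _ => by simp [hφ], fun x => by simp [hφ]⟩

/-- The Green function with pole `z`, divided by its value there. The minimum principle for `g z - g
x` shows that the pole is its maximum. -/
theorem exists_hitting (S : Sandpile V) (z : V) : ∃ p : V → ℝ, p z = 1 ∧ (∀ x, 0 ≤ p x) ∧
    (∀ x, p x ≤ 1) ∧ (∀ x, x ≠ z → S.lap p x = 0) ∧ ∀ x, 0 ≤ S.lap p x := by
  obtain ⟨g, hg⟩ := S.lap_surjective (Pi.single z 1)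
  have g0 : ∀ x, 0 ≤ g x := S.nonneg_of_lap_nonneg g fun x _ => by
    rw [hg]
    by_cases hx : x = z
    · subst hx; simp
    · simp [hx]
  have gz : 0 < g z := by
    refine lt_of_le_of_ne (g0 z) fun h => ?_
    have h1 : S.lap g z = 1 := by rw [hg]; simp
    rw [lap_apply, ← h] at h1
    have h2 : 0 ≤ ∑ w, (S.mult z w : ℝ) * g w :=
      Finset.sum_nonneg fun w _ => mul_nonneg (Nat.cast_nonneg _) (g0 w)
    linarith
  have gle : ∀ x, g x ≤ g z := by
    intro x
    have := S.nonneg_of_lap_nonneg (fun x => g z - g x) (fun x hx => by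
      have hxz : x ≠ z := by
        rintro rfl
        simp at hx
      have h1 : S.lap g x = 0 := by rw [hg]; simp [hxz]
      rw [lap_eq_sum] at h1 ⊢
      have h2 : ∑ w, (S.mult x w : ℝ) * (g z - g x - (g z - g w)) =
          -∑ w, (S.mult x w : ℝ) * (g x - g w) := by
        rw [← Finset.sum_neg_distrib]
        exact Finset.sum_congr rfl fun w _ => by ring
      rw [h2]
      have h3 : (0 : ℝ) ≤ S.sinkMult x * g z := mul_nonneg (Nat.cast_nonneg _) gz.le
      linarith) x
    linarith
  have hlap : ∀ x, S.lap ((g z)⁻¹ • g) x = (g z)⁻¹ * (Pi.single z 1 : V → ℝ) x := by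
    intro x
    rw [map_smul, hg]
    simp
  refine ⟨(g z)⁻¹ • g, ?_, fun x => ?_, fun x => ?_, fun x hx => ?_, fun x => ?_⟩
  · simp [gz.ne']
  · exact mul_nonneg (inv_nonneg.2 gz.le) (g0 x)
  · simp only [Pi.smul_apply, smul_eq_mul]
    rw [inv_mul_le_iff₀ gz]
    linarith [gle x]
  · rw [hlap]; simp [hx]
  · rw [hlap]
    refine mul_nonneg (inv_nonneg.2 gz.le) ?_
    by_cases hx : x = z
    · subst hx; simp
    · simp [hx]

/-- `S.hit z x` is the probability that the random walk from `x` hits `z` before the sink. -/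
def hit (S : Sandpile V) (z : V) : V → ℝ := (S.exists_hitting z).choose

section
variable (S : Sandpile V) (z : V)

theorem hit_self : S.hit z z = 1 := (S.exists_hitting z).choose_spec.1

theorem hit_nonneg (x : V) : 0 ≤ S.hit z x := (S.exists_hitting z).choose_spec.2.1 x

theorem hit_le_one (x : V) : S.hit z x ≤ 1 := (S.exists_hitting z).choose_spec.2.2.1 x

theorem lap_hit {x : V} (h : x ≠ z) : S.lap (S.hit z) x = 0 :=
  (S.exists_hitting z).choose_spec.2.2.2.1 x h

theorem lap_hit_nonneg (x : V) : 0 ≤ S.lap (S.hit z) x := (S.exists_hitting z).choose_spec.2.2.2.2 x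

end

/-- Reaching `w` by way of `m` is one way of reaching `w`. Analytically, the difference vanishes at
`m` and is superharmonic elsewhere. -/
theorem hit_mul_hit_le (S : Sandpile V) (w m u : V) :
    S.hit m u * S.hit w m ≤ S.hit w u := by
  have := S.nonneg_of_lap_nonneg (S.hit w - S.hit w m • S.hit m) (fun x hx => by
    have hxm : x ≠ m := by
      rintro rfl
      simp [hit_self] at hx
    rw [map_sub, map_smul]
    simp only [Pi.sub_apply, Pi.smul_apply, S.lap_hit m hxm, smul_zero, sub_zero]
    exact S.lap_hit_nonneg w x) u
  simp only [Pi.sub_apply, Pi.smul_apply, smul_eq_mul] at this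
  linarith

theorem sum_mult_hit_le (S : Sandpile V) (z x : V) :
    ∑ w, (S.mult x w : ℝ) * S.hit z w ≤ S.deg x * S.hit z x := by
  have := S.lap_hit_nonneg z x
  rw [lap_apply] at this
  linarith

theorem hit_le_deg_mul (S : Sandpile V) (z : V) {x y : V} (h : S.graph.Adj x y) :
    S.hit z y ≤ S.deg x * S.hit z x := by
  refine le_trans ?_ (S.sum_mult_hit_le z x)
  have h1 : (S.mult x y : ℝ) * S.hit z y ≤ ∑ w, (S.mult x w : ℝ) * S.hit z w :=
    Finset.single_le_sum (f := fun w => (S.mult x w : ℝ) * S.hit z w)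
      (fun w _ => mul_nonneg (Nat.cast_nonneg _) (S.hit_nonneg z w)) (Finset.mem_univ y)
  have h2 : (1 : ℝ) ≤ S.mult x y := by exact_mod_cast S.graph_adj.1 h
  nlinarith [S.hit_nonneg z y]

theorem harmonicAt_hit (S : Sandpile V) {z x : V} (h : x ≠ z) : S.HarmonicAt (S.hit z) 0 x := by
  have h1 := S.lap_hit z h
  rw [lap_apply] at h1
  have h2 := S.one_le_deg x
  unfold HarmonicAt
  rw [mul_zero, add_zero, div_eq_iff (by linarith)]
  linarith

theorem harmonicAt_one (S : Sandpile V) (x : V) : S.HarmonicAt (fun _ => 1) 1 x := by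
  have h2 := S.one_le_deg x
  unfold HarmonicAt
  rw [div_eq_iff (by linarith)]
  simp [deg]

/-! ### Legal toppling sequences and their odometers -/

/-- `S.Legal c u c'`: some sequence of legal topplings leads from `c` to `c'`, the site `x`
toppling `u x` times. -/
inductive Legal (S : Sandpile V) (c : V → ℕ) : (V → ℕ) → (V → ℕ) → Prop
  | refl : Legal S c 0 c
  | step {u c' : V → ℕ} (v : V) : Legal S c u c' → S.deg v ≤ c' v →
      Legal S c (u + Pi.single v 1) (S.topple c' v)

theorem leads_iff (S : Sandpile V) {c c' : V → ℕ} : S.Leads c c' ↔ ∃ u, S.Legal c u c' := by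
  constructor
  · intro h
    induction h with
    | refl => exact ⟨0, .refl⟩
    | tail _ hs ih =>
      obtain ⟨u, hu⟩ := ih
      obtain ⟨v, hv, rfl⟩ := hs
      exact ⟨_, .step v hu hv⟩
  · rintro ⟨u, hu⟩
    induction hu with
    | refl => exact Relation.ReflTransGen.refl
    | step v _ hv ih => exact ih.tail ⟨v, hv, rfl⟩

theorem topple_balance (S : Sandpile V) {c : V → ℕ} {v : V} (h : S.deg v ≤ c v) (x : V) :
    S.topple c v x + S.deg x * (Pi.single v 1 : V → ℕ) x = c x + S.mult v x := by
  unfold topple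
  by_cases hx : x = v
  · subst hx
    simp [S.mult_self, Nat.sub_add_cancel h]
  · simp [hx]

theorem Legal.balance {S : Sandpile V} {c u c' : V → ℕ} (h : S.Legal c u c') (x : V) :
    c' x + S.deg x * u x = c x + ∑ y, u y * S.mult y x := by
  induction h with
  | refl => simp
  | @step u c' v h hv ih =>
    have h1 := S.topple_balance hv x
    have h2 : ∑ y, (u + Pi.single v 1 : V → ℕ) y * S.mult y x =
        ∑ y, u y * S.mult y x + S.mult v x := by
      simp [add_mul, Finset.sum_add_distrib, Pi.single_apply]
    rw [h2]
    simp only [Pi.add_apply, mul_add]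
    omega

theorem Legal.trans {S : Sandpile V} {c u c' u' c'' : V → ℕ} (h : S.Legal c u c')
    (h' : S.Legal c' u' c'') : S.Legal c (u + u') c'' := by
  induction h' with
  | refl => simpa using h
  | step v _ hv ih => rw [← add_assoc]; exact .step v ih hv

theorem topple_add (S : Sandpile V) {c e : V → ℕ} {v : V} (h : S.deg v ≤ c v) :
    S.topple (c + e) v = S.topple c v + e := by
  ext x
  unfold topple
  by_cases hx : x = v
  · subst hx
    simp only [if_true, Pi.add_apply]
    omega
  · simp only [hx, if_false, Pi.add_apply]
    omega

theorem Legal.add_right {S : Sandpile V} {c u c' : V → ℕ} (h : S.Legal c u c') (e : V → ℕ) :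
    S.Legal (c + e) u (c' + e) := by
  induction h with
  | refl => exact .refl
  | step v _ hv ih =>
    rw [← S.topple_add hv]
    exact .step v ih (hv.trans (Nat.le_add_right _ _))

/-- If the sites can legally topple `u` times from `c`, and `c₁` arises from `c` by (possibly
illegal) topplings `a`, then the remaining topplings `u - a` can be done legally from `c₁`. -/
theorem Legal.residual {S : Sandpile V} {c u c' : V → ℕ} (h : S.Legal c u c') {a c₁ : V → ℕ}
    (hc : ∀ x, c₁ x + S.deg x * a x = c x + ∑ y, a y * S.mult y x) :
    ∃ c₂, S.Legal c₁ (u - a) c₂ := by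
  induction h with
  | refl => exact ⟨c₁, by simpa using Legal.refl⟩
  | @step u c' v h hv ih =>
    obtain ⟨c₂, h₂⟩ := ih
    by_cases hva : u v < a v
    -- This toppling of `v` is already contained in `a`, so nothing remains to be done.
    · refine ⟨c₂, ?_⟩
      convert h₂ using 1
      ext x
      by_cases hx : x = v
      · subst hx
        simp only [Pi.sub_apply, Pi.add_apply, Pi.single_eq_same]
        omega
      · simp [hx]
    · push Not at hva
      have e : u + Pi.single v 1 - a = u - a + Pi.single v 1 := by
        ext x
        by_cases hx : x = v
        · subst hx
          simp only [Pi.sub_apply, Pi.add_apply, Pi.single_eq_same]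
          omega
        · simp [hx]
      rw [e]
      refine ⟨_, .step v h₂ ?_⟩
      have b1 := h.balance v
      have b2 := h₂.balance v
      have b3 := hc v
      -- Together, `a` and `u - a` topple each neighbour at least `u y` times but `v` exactly `u v`
      -- times, so `v` holds at least as much as in the given sequence and may topple.
      have b4 : ∑ y, u y * S.mult y v ≤ ∑ y, a y * S.mult y v + ∑ y, (u - a) y * S.mult y v := by
        rw [← Finset.sum_add_distrib]
        refine Finset.sum_le_sum fun y _ => ?_
        rw [← add_mul]
        exact Nat.mul_le_mul_right _ (by simp only [Pi.sub_apply]; omega)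
      have b5 : S.deg v * (u - a) v + S.deg v * a v = S.deg v * u v := by
        rw [← mul_add, Pi.sub_apply, Nat.sub_add_cancel hva]
      omega

/-- A site that never topples only gains particles, so being touched survives in any longer run from
the same configuration. -/
theorem Legal.touched_mono {S : Sandpile V} {c u c' U C : V → ℕ} (h : S.Legal c u c')
    (H : S.Legal c U C) (huU : u ≤ U) {w : V} (hw : 0 < u w ∨ 1 ≤ c' w) : 0 < U w ∨ 1 ≤ C w := by
  by_cases hU : U w = 0
  · right
    have hu : u w = 0 := Nat.le_zero.1 (hU ▸ huU w)
    have b1 := h.balance w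
    have b2 := H.balance w
    have b3 : ∑ y, u y * S.mult y w ≤ ∑ y, U y * S.mult y w :=
      Finset.sum_le_sum fun y _ => Nat.mul_le_mul_right _ (huU y)
    rw [hu, mul_zero] at b1
    rw [hU, mul_zero] at b2
    omega
  · left; omega

/-- Different sites may be flooded by different runs. `Legal.residual` merges them into one run
whose odometer is the pointwise maximum, and `Legal.touched_mono` keeps what was already touched. -/
theorem exists_legal_touching (S : Sandpile V) (c : V → ℕ) (B : Finset V)
    (hB : ∀ w ∈ B, S.Floods c w) :
    ∃ u c', S.Legal c u c' ∧ ∀ w ∈ B, 0 < u w ∨ 1 ≤ c' w := by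
  induction B using Finset.induction_on with
  | empty => exact ⟨0, c, .refl, by simp⟩
  | insert b B hb ih =>
    obtain ⟨u, c', h, ht⟩ := ih fun w hw => hB w (Finset.mem_insert_of_mem hw)
    obtain ⟨c₁, hl, hc₁⟩ := hB b (Finset.mem_insert_self _ _)
    obtain ⟨u₁, h₁⟩ := S.leads_iff.1 hl
    obtain ⟨c₂, h₂⟩ := h₁.residual h.balance
    have H := h.trans h₂
    refine ⟨_, c₂, H, fun w hw => ?_⟩
    rcases Finset.mem_insert.1 hw with rfl | hw
    · refine h₁.touched_mono H (fun x => ?_) (Or.inr hc₁)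
      simp only [Pi.add_apply, Pi.sub_apply]
      omega
    · exact h.touched_mono H (fun x => by simp) (ht w hw)

/-- A toppled site `x` that is now empty has received nothing since its last toppling, so no
neighbour has toppled since. Each neighbour `y` thus still holds the `mult x y` particles sent to it
then, and those sent by different `x` are distinct. -/
theorem Legal.sum_mult_empty_le {S : Sandpile V} {c u c' : V → ℕ} (h : S.Legal c u c') (y : V) :
    ∑ x with 0 < u x ∧ c' x = 0, S.mult x y ≤ c' y := by
  induction h generalizing y with
  | refl => simp
  | @step u c' v h hv ih =>
    by_cases hy : y = v
    · subst hy
      rw [Finset.sum_eq_zero]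
      · exact Nat.zero_le _
      · intro x hx
        simp only [Finset.mem_filter, Finset.mem_univ, true_and] at hx
        by_cases hxy : x = y
        · rw [hxy, S.mult_self]
        · have h1 := hx.2
          simp only [topple, hxy, if_false] at h1
          rw [S.mult_symm]
          omega
    · have h1 : S.topple c' v y = c' y + S.mult v y := by simp [topple, hy]
      rw [h1]
      refine le_trans ?_ (Nat.add_le_add_right (ih y) _)
      have hsub : (Finset.univ.filter fun x =>
          0 < (u + Pi.single v 1 : V → ℕ) x ∧ S.topple c' v x = 0) ⊆
          insert v (Finset.univ.filter fun x => 0 < u x ∧ c' x = 0) := by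
        intro x hx
        simp only [Finset.mem_filter, Finset.mem_univ, true_and, Finset.mem_insert] at hx ⊢
        by_cases hxv : x = v
        · exact Or.inl hxv
        · right
          simp only [Pi.add_apply, Pi.single_eq_of_ne hxv, topple, hxv, if_false] at hx
          omega
      refine (Finset.sum_le_sum_of_subset hsub).trans ?_
      by_cases hm : v ∈ Finset.univ.filter fun x => 0 < u x ∧ c' x = 0
      · rw [Finset.insert_eq_of_mem hm]
        omega
      · rw [Finset.sum_insert hm]
        omega

/-- Summation by parts, using the symmetry of the Laplacian. -/
theorem Legal.sum_mul {S : Sandpile V} {c u c' : V → ℕ} (h : S.Legal c u c') (p : V → ℝ) :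
    ∑ x, (c' x : ℝ) * p x + ∑ x, (u x : ℝ) * S.lap p x = ∑ x, (c x : ℝ) * p x := by
  have h1 : ∀ x, (c' x : ℝ) * p x + S.deg x * u x * p x =
      c x * p x + ∑ y, (u y : ℝ) * S.mult y x * p x := by
    intro x
    have := h.balance x
    have h2 : (c' x : ℝ) + S.deg x * u x = c x + ∑ y, (u y : ℝ) * S.mult y x := by
      exact_mod_cast this
    rw [← Finset.sum_mul, ← add_mul, ← add_mul, h2]
  have h2 : ∑ x, (u x : ℝ) * S.lap p x =
      ∑ x, (S.deg x : ℝ) * u x * p x - ∑ x, ∑ y, (u y : ℝ) * S.mult y x * p x := by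
    rw [Finset.sum_comm, ← Finset.sum_sub_distrib]
    refine Finset.sum_congr rfl fun x _ => ?_
    rw [lap_apply, mul_sub, Finset.mul_sum]
    congr 1
    · ring
    · exact Finset.sum_congr rfl fun y _ => by ring
  have h3 := Finset.sum_congr (rfl : (Finset.univ : Finset V) = Finset.univ) fun x _ => h1 x
  rw [Finset.sum_add_distrib, Finset.sum_add_distrib] at h3
  linarith

theorem Legal.sum_mul_le {S : Sandpile V} {c u c' : V → ℕ} (h : S.Legal c u c') {p : V → ℝ}
    (hp : ∀ x, 0 ≤ S.lap p x) : ∑ x, (c' x : ℝ) * p x ≤ ∑ x, (c x : ℝ) * p x := by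
  have := h.sum_mul p
  have h2 : 0 ≤ ∑ x, (u x : ℝ) * S.lap p x :=
    Finset.sum_nonneg fun x _ => mul_nonneg (Nat.cast_nonneg _) (hp x)
  linarith

/-- If `c` floods every site of `B`, the total mass over `B` of a nonnegative superharmonic
function that is harmonic on `B` is at most twice its integral against `c`. -/
theorem sum_le_two_mul_of_floods (S : Sandpile V) {c : V → ℕ} {B : Finset V} {p : V → ℝ}
    (hB : ∀ w ∈ B, S.Floods c w) (p0 : ∀ x, 0 ≤ p x) (hp : ∀ x, 0 ≤ S.lap p x)
    (hpB : ∀ x ∈ B, S.lap p x = 0) : ∑ x ∈ B, p x ≤ 2 * ∑ x, (c x : ℝ) * p x := by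
  obtain ⟨u, c', h, ht⟩ := S.exists_legal_touching c B hB
  have h1 := h.sum_mul_le hp
  have h2 : ∑ x ∈ B with 1 ≤ c' x, p x ≤ ∑ x, (c' x : ℝ) * p x := by
    refine (Finset.sum_le_sum (g := fun x => (c' x : ℝ) * p x) fun x hx => ?_).trans
      (Finset.sum_le_sum_of_subset_of_nonneg (Finset.subset_univ _)
        fun x _ _ => mul_nonneg (Nat.cast_nonneg _) (p0 x))
    have : (1 : ℝ) ≤ c' x := by exact_mod_cast (Finset.mem_filter.1 hx).2
    nlinarith [p0 x]
  -- At an empty touched site, harmonicity bounds `p x` by the sum over its edges, and by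
  -- `Legal.sum_mult_empty_le` the particles at the other ends pay for it. Occupied and empty sites
  -- each use up the weight of `c'` once, hence the factor `2`.
  have h3 : ∑ x ∈ B with ¬ 1 ≤ c' x, p x ≤ ∑ x, (c' x : ℝ) * p x := by
    calc ∑ x ∈ B with ¬ 1 ≤ c' x, p x
        ≤ ∑ x ∈ B with ¬ 1 ≤ c' x, ∑ y, (S.mult x y : ℝ) * p y := by
          refine Finset.sum_le_sum fun x hx => ?_
          have h4 := hpB x (Finset.mem_filter.1 hx).1
          rw [lap_apply] at h4
          nlinarith [p0 x, S.one_le_deg x]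
      _ ≤ ∑ x with 0 < u x ∧ c' x = 0, ∑ y, (S.mult x y : ℝ) * p y := by
          refine Finset.sum_le_sum_of_subset_of_nonneg (fun x hx => ?_) fun x _ _ =>
            Finset.sum_nonneg fun y _ => mul_nonneg (Nat.cast_nonneg _) (p0 y)
          rw [Finset.mem_filter] at hx
          have := ht x hx.1
          simp only [Finset.mem_filter, Finset.mem_univ, true_and]
          omega
      _ = ∑ y, ((∑ x with 0 < u x ∧ c' x = 0, S.mult x y : ℕ) : ℝ) * p y := by
          rw [Finset.sum_comm]
          refine Finset.sum_congr rfl fun y _ => ?_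
          push_cast
          rw [Finset.sum_mul]
      _ ≤ ∑ y, (c' y : ℝ) * p y := by
          refine Finset.sum_le_sum fun y _ => ?_
          exact mul_le_mul_of_nonneg_right (by exact_mod_cast h.sum_mult_empty_le y) (p0 y)
  have h4 := Finset.sum_filter_add_sum_filter_not B (fun x => 1 ≤ c' x) p
  linarith

theorem le_sum_of_floods (S : Sandpile V) {c : V → ℕ} {z : V} {p : V → ℝ}
    (hz : S.Floods c z) (p0 : ∀ x, 0 ≤ p x) (hp : ∀ x, 0 ≤ S.lap p x) :
    p z ≤ ∑ x, (c x : ℝ) * p x := by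
  obtain ⟨c', hl, hc⟩ := hz
  obtain ⟨u, h⟩ := S.leads_iff.1 hl
  refine le_trans ?_ (h.sum_mul_le hp)
  have h1 : (c' z : ℝ) * p z ≤ ∑ x, (c' x : ℝ) * p x :=
    Finset.single_le_sum (f := fun x => (c' x : ℝ) * p x)
      (fun x _ => mul_nonneg (Nat.cast_nonneg _) (p0 x)) (Finset.mem_univ z)
  have : (1 : ℝ) ≤ c' z := by exact_mod_cast hc
  nlinarith [p0 z]

theorem Topples.floods {S : Sandpile V} {c : V → ℕ} {w : V} (h : S.Topples c w) :
    S.Floods c w := by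
  obtain ⟨c', hl, hc⟩ := h
  exact ⟨c', hl, (S.deg_pos w).trans_le hc⟩

/-! ### Recurrence -/

theorem exists_nat_superharmonic (S : Sandpile V) (c : V → ℕ) :
    ∃ y : V → ℕ, ∀ x, c x + ∑ w, y w * S.mult w x ≤ S.deg x * y x := by
  obtain ⟨φ, φ0, hφ⟩ := S.exists_lap_eq_one
  -- The degree is the allowance for rounding up: each neighbour contributes an error of at most its
  -- multiplicity.
  let t : ℝ := ∑ x, ((c x : ℝ) + S.deg x)
  have ht : ∀ x, (c x : ℝ) + S.deg x ≤ t := fun x =>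
    Finset.single_le_sum (f := fun x => (c x : ℝ) + S.deg x) (fun x _ => by positivity)
      (Finset.mem_univ x)
  have t0 : 0 ≤ t := Finset.sum_nonneg fun x _ => by positivity
  refine ⟨fun x => ⌈t * φ x⌉₊, fun x => ?_⟩
  have h1 := hφ x
  rw [lap_apply] at h1
  have h2 : t * φ x ≤ ⌈t * φ x⌉₊ := Nat.le_ceil _
  have h3 : ∑ w, (⌈t * φ w⌉₊ : ℝ) * S.mult w x ≤
      t * ∑ w, (S.mult x w : ℝ) * φ w + S.deg x := by
    have h4 : ∑ w, (S.mult x w : ℝ) ≤ S.deg x := by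
      unfold deg
      push_cast
      linarith [Nat.cast_nonneg (α := ℝ) (S.sinkMult x)]
    calc ∑ w, (⌈t * φ w⌉₊ : ℝ) * S.mult w x
        ≤ ∑ w, (t * (S.mult x w * φ w) + S.mult x w) := by
          refine Finset.sum_le_sum fun w _ => ?_
          rw [S.mult_symm w x]
          have := (Nat.ceil_lt_add_one (mul_nonneg t0 (φ0 w))).le
          have := mul_le_mul_of_nonneg_right this (Nat.cast_nonneg (α := ℝ) (S.mult x w))
          linarith
      _ = t * ∑ w, (S.mult x w : ℝ) * φ w + ∑ w, (S.mult x w : ℝ) := by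
          rw [Finset.sum_add_distrib, Finset.mul_sum]
      _ ≤ _ := by linarith
  have h5 : (c x : ℝ) + ∑ w, (⌈t * φ w⌉₊ : ℝ) * S.mult w x ≤ S.deg x * ⌈t * φ x⌉₊ := by
    have h6 := mul_le_mul_of_nonneg_left h2 (Nat.cast_nonneg (α := ℝ) (S.deg x))
    have h7 : t * ((S.deg x : ℝ) * φ x) - t * ∑ w, (S.mult x w : ℝ) * φ w = t := by
      rw [← mul_sub, h1, mul_one]
    linarith [ht x]
  exact_mod_cast h5

/-- Dhar's burning test. Undoing all but the topplings `u - 1` turns `s` into `s + sinkMult`; the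
residual run topples every site once, and the sink takes exactly what was added. This is repeated
`K` times. -/
theorem Legal.burning {S : Sandpile V} {a u s : V → ℕ} (h : S.Legal a u s)
    (hu : ∀ x, 0 < u x) (K : ℕ) : S.Legal (s + K • S.sinkMult) (fun _ => K) s := by
  have one : S.Legal (s + S.sinkMult) (fun _ => 1) s := by
    have hc : ∀ x, (s + S.sinkMult) x + S.deg x * (u x - 1) =
        a x + ∑ y, (u y - 1) * S.mult y x := by
      intro x
      have b := h.balance x
      have e1 : ∑ y, u y * S.mult y x = ∑ y, (u y - 1) * S.mult y x + ∑ y, S.mult y x := by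
        rw [← Finset.sum_add_distrib]
        refine Finset.sum_congr rfl fun y _ => ?_
        rw [← Nat.succ_mul, Nat.succ_eq_add_one, Nat.sub_add_cancel (hu y)]
      have e2 : S.deg x * u x = S.deg x * (u x - 1) + S.deg x := by
        rw [← Nat.mul_succ, Nat.succ_eq_add_one, Nat.sub_add_cancel (hu x)]
      have e3 : S.deg x = ∑ y, S.mult y x + S.sinkMult x := by
        unfold deg
        simp_rw [S.mult_symm x]
      simp only [Pi.add_apply]
      omega
    obtain ⟨c₂, h₂⟩ := h.residual (a := fun x => u x - 1) hc
    have e : (u - fun x => u x - 1) = fun _ => 1 := by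
      ext x
      have := hu x
      simp only [Pi.sub_apply]
      omega
    rw [e] at h₂
    have : c₂ = s := by
      ext x
      have b := h₂.balance x
      have e3 : S.deg x = ∑ y, S.mult y x + S.sinkMult x := by
        unfold deg
        simp_rw [S.mult_symm x]
      simp only [one_mul, mul_one, Pi.add_apply] at b
      omega
    exact this ▸ h₂
  induction K with
  | zero =>
    rw [zero_nsmul, add_zero]
    exact .refl
  | succ K ih =>
    have h1 := (one.add_right (K • S.sinkMult)).trans ih
    convert h1 using 1
    · rw [succ_nsmul]
      ring
    · ext x
      simp [add_comm]

/-- A configuration reached by a toppling sequence in which every site topples is recurrent. -/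
theorem Legal.recurrent {S : Sandpile V} {a u s : V → ℕ} (h : S.Legal a u s)
    (hu : ∀ x, 0 < u x) : S.Recurrent s := by
  intro c
  obtain ⟨y, hy⟩ := S.exists_nat_superharmonic c
  let K := ∑ x, y x
  have hK : ∀ x, y x ≤ K := fun x => Finset.single_le_sum (fun _ _ => Nat.zero_le _)
    (Finset.mem_univ x)
  -- This is `s` plus the Laplacian of `y`, hence above `c`. It is what `K - y` topplings, legal or
  -- not, make of the starting point of the burning run; the residual `y` is then legal and ends at
  -- `s`.
  let c₁ : V → ℕ := fun x => s x + (S.deg x * y x - ∑ w, y w * S.mult w x)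
  have e3 : ∀ x, S.deg x = ∑ y, S.mult y x + S.sinkMult x := by
    intro x
    unfold deg
    simp_rw [S.mult_symm x]
  obtain ⟨c₂, h₂⟩ := (h.burning hu K).residual (a := fun x => K - y x) (c₁ := c₁) (fun x => by
    have h1 : ∑ w, (K - y w) * S.mult w x + ∑ w, y w * S.mult w x = K * ∑ w, S.mult w x := by
      rw [← Finset.sum_add_distrib, Finset.mul_sum]
      refine Finset.sum_congr rfl fun w _ => ?_
      rw [← add_mul, Nat.sub_add_cancel (hK w)]
    have h2 : S.deg x * (K - y x) + S.deg x * y x = K * ∑ y, S.mult y x + K * S.sinkMult x := by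
      rw [← mul_add, Nat.sub_add_cancel (hK x), ← mul_add, ← e3, mul_comm]
    have h3 := hy x
    simp only [c₁, Pi.add_apply, Pi.smul_apply, smul_eq_mul]
    omega)
  refine ⟨c₁, fun x => ?_, S.leads_iff.2 ⟨y, ?_⟩⟩
  · have h3 := hy x
    simp only [c₁]
    omega
  · have e : ((fun _ => K) - fun x => K - y x) = y := by
      ext x
      have := hK x
      simp only [Pi.sub_apply]
      omega
    rw [e] at h₂
    have : c₂ = s := by
      ext x
      have b := h₂.balance x
      have h3 := hy x
      simp only [c₁] at b
      omega
    exact this ▸ h₂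

theorem Evolves.exists_legal {S : Sandpile V} {N : ℕ} {s : V → ℕ} (h : S.Evolves N s) :
    ∃ a u, ∑ x, a x = N ∧ S.Legal a u s := by
  induction h with
  | empty => exact ⟨0, 0, by simp, .refl⟩
  | @add N s s' v _ hl _ ih =>
    obtain ⟨a, u, ha, h⟩ := ih
    obtain ⟨u', h'⟩ := S.leads_iff.1 hl
    exact ⟨a + Pi.single v 1, _, by simp [Finset.sum_add_distrib, ha],
      (h.add_right (Pi.single v 1)).trans h'⟩

theorem Evolves.lt_deg {S : Sandpile V} {N : ℕ} {s : V → ℕ} (h : S.Evolves N s) (x : V) :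
    s x < S.deg x := by
  cases h with
  | empty => exact S.deg_pos x
  | add v _ _ hs => exact hs x

theorem sum_stable_mul_le (S : Sandpile V) {Δ : ℝ} (hΔ : ∀ v, (S.deg v : ℝ) ≤ Δ) {s : V → ℕ}
    (hs : ∀ x, s x < S.deg x) (w : V) :
    ∑ x, (s x : ℝ) * S.hit w x ≤ (Δ - 1) * Fintype.card V := by
  have : ∀ x ∈ Finset.univ, (s x : ℝ) * S.hit w x ≤ Δ - 1 := by
    intro x _
    have h1 : (s x : ℝ) + 1 ≤ S.deg x := by exact_mod_cast hs x
    have h2 := hΔ x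
    have h3 : (s x : ℝ) * S.hit w x ≤ s x :=
      mul_le_of_le_one_right (Nat.cast_nonneg _) (S.hit_le_one w x)
    linarith
  refine (Finset.sum_le_sum this).trans (le_of_eq ?_)
  rw [Finset.sum_const, Finset.card_univ, nsmul_eq_mul, mul_comm]

/-- A lower bound `ε` for all hitting probabilities bounds the transience class. -/
theorem mul_le_of_mem_transientCounts (S : Sandpile V) {Δ ε : ℝ} (hΔ : ∀ v, (S.deg v : ℝ) ≤ Δ)
    (hε : ∀ u w, ε ≤ S.hit w u) {N : ℕ} (hN : N ∈ S.transientCounts) :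
    N * ε ≤ (Δ - 1) * Fintype.card V := by
  obtain ⟨s, hev, hrec⟩ := hN
  obtain ⟨a, u, ha, h⟩ := hev.exists_legal
  -- In a transient state some `w` has never toppled, so the weight against `hit w` was conserved
  -- exactly.
  obtain ⟨w, hw⟩ : ∃ w, u w = 0 := by
    by_contra! hne
    exact hrec (h.recurrent fun x => Nat.pos_of_ne_zero (hne x))
  have h1 := h.sum_mul (S.hit w)
  have h2 : ∑ x, (u x : ℝ) * S.lap (S.hit w) x = 0 := by
    refine Finset.sum_eq_zero fun x _ => ?_
    by_cases hx : x = w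
    · rw [hx, hw]; simp
    · rw [S.lap_hit w hx, mul_zero]
  have h3 : (N : ℝ) * ε ≤ ∑ x, (a x : ℝ) * S.hit w x := by
    rw [← ha]
    push_cast
    rw [Finset.sum_mul]
    exact Finset.sum_le_sum fun x _ => mul_le_mul_of_nonneg_left (hε x w) (Nat.cast_nonneg _)
  linarith [S.sum_stable_mul_le hΔ hev.lt_deg w]

/-! ### Termination -/

/-- The weight against a nonnegative `φ` with Laplacian `1` drops by exactly one at each toppling.
-/
theorem exists_legal_stable (S : Sandpile V) (c : V → ℕ) :
    ∃ u c', S.Legal c u c' ∧ S.Stable c' := by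
  obtain ⟨φ, φ0, hφ⟩ := S.exists_lap_eq_one
  obtain ⟨n, hn⟩ := exists_nat_gt (∑ x, (c x : ℝ) * φ x)
  induction n generalizing c with
  | zero =>
    exact absurd hn (not_lt.2 (by
      simpa using Finset.sum_nonneg fun x _ => mul_nonneg (Nat.cast_nonneg (α := ℝ) (c x)) (φ0 x)))
  | succ n ih =>
    by_cases hs : S.Stable c
    · exact ⟨0, c, .refl, hs⟩
    · unfold Stable at hs
      push Not at hs
      obtain ⟨v, hv⟩ := hs
      have h1 : S.Legal c (0 + Pi.single v 1) (S.topple c v) := .step v .refl hv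
      have h2 := h1.sum_mul φ
      have h3 : ∑ x, (((0 + Pi.single v 1 : V → ℕ) x : ℕ) : ℝ) * S.lap φ x = 1 := by
        simp [hφ, Pi.single_apply]
      rw [h3] at h2
      push_cast at hn
      obtain ⟨u, c', h4, h5⟩ := ih (S.topple c v) (by linarith)
      exact ⟨_, c', h1.trans h4, h5⟩

theorem Legal.apply_eq_zero {S : Sandpile V} {c u c' : V → ℕ} (h : S.Legal c u c') {w : V}
    (hw : ¬ S.Topples c w) : u w = 0 := by
  induction h with
  | refl => rfl
  | @step u c' v h hv ih =>
    have : w ≠ v := by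
      rintro rfl
      exact hw ⟨c', S.leads_iff.2 ⟨u, h⟩, hv⟩
    simp [ih, this]

/-- Were `w` never to topple, stabilising would conserve the weight against `hit w`, and no stable
configuration weighs that much. -/
theorem topples_of_lt (S : Sandpile V) {Δ : ℝ} (hΔ : ∀ v, (S.deg v : ℝ) ≤ Δ) {u w : V} {N : ℕ}
    (hN : (Δ - 1) * Fintype.card V < N * S.hit w u) : S.Topples (Pi.single u N) w := by
  by_contra hw
  obtain ⟨a, s, h, hs⟩ := S.exists_legal_stable (Pi.single u N)
  have h1 := h.sum_mul (S.hit w)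
  have h2 : ∑ x, (a x : ℝ) * S.lap (S.hit w) x = 0 := by
    refine Finset.sum_eq_zero fun x _ => ?_
    by_cases hx : x = w
    · rw [hx, h.apply_eq_zero hw]; simp
    · rw [S.lap_hit w hx, mul_zero]
  have h3 : ∑ x, (((Pi.single u N : V → ℕ) x : ℕ) : ℝ) * S.hit w x = N * S.hit w u := by
    simp [Pi.single_apply]
  linarith [S.sum_stable_mul_le hΔ hs w]

/-! ### Distances, balls and volumes -/

theorem dist_triangle (S : Sandpile V) (u v w : V) :
    S.graph.dist u w ≤ S.graph.dist u v + S.graph.dist v w :=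
  S.graph_connected.dist_triangle

theorem mem_ball (S : Sandpile V) {v w : V} {r : ℕ} : w ∈ S.ball v r ↔ S.graph.dist v w ≤ r := by
  simp [ball]

theorem ball_subset_ball (S : Sandpile V) {v w : V} {r s : ℕ} (h : S.graph.dist v w + s ≤ r) :
    S.ball w s ⊆ S.ball v r := by
  intro x hx
  rw [mem_ball] at hx ⊢
  have := S.dist_triangle v w x
  omega

theorem exists_eta (S : Sandpile V) (v : V) :
    ∃ b, 0 < S.sinkMult b ∧ S.graph.dist v b = S.eta v := by
  obtain ⟨b, hb⟩ := S.exists_sink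
  exact Nat.sInf_mem (s := {d | ∃ b, 0 < S.sinkMult b ∧ S.graph.dist v b = d}) ⟨_, b, hb, rfl⟩

theorem eta_le_dist_add (S : Sandpile V) (v w : V) : S.eta v ≤ S.graph.dist v w + S.eta w := by
  obtain ⟨b, hb, hd⟩ := S.exists_eta w
  have h1 : S.eta v ≤ S.graph.dist v b := Nat.sInf_le ⟨b, hb, rfl⟩
  have h2 := S.dist_triangle v w b
  omega

theorem exists_isPath_length_lt (S : Sandpile V) (u v : V) :
    ∃ P : S.graph.Walk u v, P.IsPath ∧ P.length + 2 ≤ S.size := by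
  obtain ⟨P, hP, _⟩ := S.graph_connected.exists_path_of_dist u v
  have := hP.length_lt
  exact ⟨P, hP, by unfold size; omega⟩

theorem eta_add_two_le (S : Sandpile V) (v : V) : S.eta v + 2 ≤ S.size := by
  obtain ⟨b, _, hd⟩ := S.exists_eta v
  obtain ⟨P, _, hP⟩ := S.exists_isPath_length_lt v b
  have := S.graph.dist_le P
  omega

theorem vol_le (S : Sandpile V) {Δ : ℝ} (hΔ : ∀ v, (S.deg v : ℝ) ≤ Δ) (v : V) (r : ℕ) :
    S.vol v r ≤ Δ * S.size := by
  have hd : ∀ u, ∑ w ∈ S.ball v r, (S.mult u w : ℝ) ≤ Δ := by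
    intro u
    refine le_trans ?_ (hΔ u)
    have h1 : ∑ w ∈ S.ball v r, (S.mult u w : ℝ) ≤ ∑ w, (S.mult u w : ℝ) :=
      Finset.sum_le_sum_of_subset_of_nonneg (Finset.subset_univ _) fun _ _ _ => Nat.cast_nonneg _
    unfold deg
    push_cast
    linarith [Nat.cast_nonneg (α := ℝ) (S.sinkMult u)]
  have hΔ0 : 0 ≤ Δ := by linarith [hΔ v, S.one_le_deg v]
  have h2 : ∑ u ∈ S.ball v r, ∑ w ∈ S.ball v r, (S.mult u w : ℝ) ≤ Δ * S.size := by
    refine (Finset.sum_le_sum fun u _ => hd u).trans ?_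
    rw [Finset.sum_const, nsmul_eq_mul, mul_comm]
    refine mul_le_mul_of_nonneg_left ?_ hΔ0
    have := Finset.card_le_univ (S.ball v r)
    unfold size
    exact_mod_cast (by omega)
  unfold vol
  have h3 : (0 : ℝ) ≤ Δ * S.size := mul_nonneg hΔ0 (Nat.cast_nonneg _)
  linarith

theorem vol_nonneg (S : Sandpile V) (v : V) (r : ℕ) : 0 ≤ S.vol v r := by
  unfold vol
  positivity

theorem dist_getVert_le (S : Sandpile V) {u v : V} (P : S.graph.Walk u v) {i j : ℕ} (hij : i ≤ j) :
    S.graph.dist (P.getVert i) (P.getVert j) ≤ j - i := by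
  induction j, hij using Nat.le_induction with
  | base => simp
  | succ j hij ih =>
    have h1 := S.dist_triangle (P.getVert i) (P.getVert j) (P.getVert (j + 1))
    have h2 : S.graph.dist (P.getVert j) (P.getVert (j + 1)) ≤ 1 := by
      by_cases hj : j < P.length
      · rw [SimpleGraph.dist_eq_one_iff_adj.2 (P.adj_getVert_succ hj)]
      · rw [P.getVert_of_length_le (by omega), P.getVert_of_length_le (by omega)]
        simp
    omega

/-! ### Lower bounds for hitting probabilities along a walk -/

theorem hit_getVert_le (S : Sandpile V) {Δ : ℝ} (hΔ : ∀ v, (S.deg v : ℝ) ≤ Δ) (z : V) {u v : V}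
    (P : S.graph.Walk u v) (i t : ℕ) (h : i + t ≤ P.length) :
    S.hit z (P.getVert (i + t)) ≤ Δ ^ t * S.hit z (P.getVert i) := by
  induction t with
  | zero => simp
  | succ t ih =>
    have h1 := S.hit_le_deg_mul z (P.adj_getVert_succ (i := i + t) (by omega))
    have h2 := ih (by omega)
    have h3 := hΔ (P.getVert (i + t))
    have h4 := S.one_le_deg (P.getVert (i + t))
    calc S.hit z (P.getVert (i + (t + 1)))
        ≤ S.deg (P.getVert (i + t)) * S.hit z (P.getVert (i + t)) := h1
      _ ≤ Δ * (Δ ^ t * S.hit z (P.getVert i)) :=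
          mul_le_mul h3 h2 (S.hit_nonneg _ _) (by linarith)
      _ = Δ ^ (t + 1) * S.hit z (P.getVert i) := by ring

theorem one_le_pow_mul_hit (S : Sandpile V) {Δ : ℝ} (hΔ : ∀ v, (S.deg v : ℝ) ≤ Δ) {u z : V}
    (P : S.graph.Walk u z) : 1 ≤ Δ ^ P.length * S.hit z u := by
  have := S.hit_getVert_le hΔ z P 0 P.length (by simp)
  simpa [hit_self] using this

/-- If all degrees are at most two, the hitting probability is concave along simple paths. -/
theorem one_le_size_mul_hit (S : Sandpile V) (h2 : ∀ v, S.deg v ≤ 2) (u z : V) :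
    1 ≤ (S.size : ℝ) * S.hit z u := by
  obtain ⟨P, hP, hl⟩ := S.exists_isPath_length_lt u z
  set p := S.hit z with hp
  have hsum : ∀ x, ∑ w, (S.mult x w : ℝ) * p w ≤ 2 * p x := by
    intro x
    have h3 : (S.deg x : ℝ) ≤ 2 := by exact_mod_cast h2 x
    nlinarith [S.sum_mult_hit_le z x, S.hit_nonneg z x]
  -- With degree at most two, superharmonicity makes the increments along the path nonincreasing,
  -- and the first is at most `p u`. Simplicity of the path makes the two neighbours distinct.
  have key : ∀ j, j ≤ P.length → p (P.getVert j) ≤ (j + 1) * p u ∧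
      (j + 1 ≤ P.length → p (P.getVert (j + 1)) - p (P.getVert j) ≤ p u) := by
    intro j
    induction j with
    | zero =>
      intro _
      refine ⟨by simp, fun h => ?_⟩
      have h3 := S.graph_adj.1 (P.adj_getVert_succ (i := 0) (by omega))
      have h4 : (S.mult (P.getVert 0) (P.getVert 1) : ℝ) * p (P.getVert 1) ≤
          ∑ w, (S.mult (P.getVert 0) w : ℝ) * p w :=
        Finset.single_le_sum (f := fun w => (S.mult (P.getVert 0) w : ℝ) * p w)
          (fun w _ => mul_nonneg (Nat.cast_nonneg _) (S.hit_nonneg z w)) (Finset.mem_univ _)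
      have h5 : (1 : ℝ) ≤ S.mult (P.getVert 0) (P.getVert 1) := by exact_mod_cast h3
      have h6 := hsum (P.getVert 0)
      have h7 := S.hit_nonneg z (P.getVert 1)
      rw [← hp] at h7
      simp only [SimpleGraph.Walk.getVert_zero, zero_add] at h4 h5 h6 ⊢
      nlinarith
    | succ j ih =>
      intro hj
      obtain ⟨i1, i2⟩ := ih (by omega)
      have i3 := i2 hj
      refine ⟨by push_cast; linarith, fun h => ?_⟩
      have a1 := S.graph_adj.1 (P.adj_getVert_succ (i := j) (by omega))
      have a2 := S.graph_adj.1 (P.adj_getVert_succ (i := j + 1) (by omega))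
      have hne : P.getVert j ≠ P.getVert (j + 1 + 1) := by
        intro he
        have := hP.getVert_injOn (by simp; omega) (by simp; omega) he
        omega
      rw [S.mult_symm] at a1
      have h4 : ∑ w ∈ {P.getVert j, P.getVert (j + 1 + 1)},
          (S.mult (P.getVert (j + 1)) w : ℝ) * p w ≤
          ∑ w, (S.mult (P.getVert (j + 1)) w : ℝ) * p w :=
        Finset.sum_le_sum_of_subset_of_nonneg (Finset.subset_univ _)
          (fun w _ _ => mul_nonneg (Nat.cast_nonneg _) (S.hit_nonneg z w))
      rw [Finset.sum_pair hne] at h4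
      have h5 : (1 : ℝ) ≤ S.mult (P.getVert (j + 1)) (P.getVert j) := by exact_mod_cast a1
      have h6 : (1 : ℝ) ≤ S.mult (P.getVert (j + 1)) (P.getVert (j + 1 + 1)) := by
        exact_mod_cast a2
      have h7 := S.hit_nonneg z (P.getVert j)
      have h8 := S.hit_nonneg z (P.getVert (j + 1 + 1))
      rw [← hp] at h7 h8
      have h9 := hsum (P.getVert (j + 1))
      nlinarith
  have h3 := (key P.length le_rfl).1
  rw [P.getVert_length, hp, hit_self] at h3
  have h4 : (P.length : ℝ) + 2 ≤ S.size := by exact_mod_cast hl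
  nlinarith [S.hit_nonneg z u]

/-! ### Comparison of hitting probabilities on balls -/

theorem sum_single_mul (v : V) (N : ℕ) (p : V → ℝ) :
    ∑ x, (((Pi.single v N : V → ℕ) x : ℕ) : ℝ) * p x = N * p v := by
  simp [Pi.single_apply]

/-- High local conductance of a single sandpile. -/
def Conductive (S : Sandpile V) (Cσ : ℝ) : Prop :=
  ∀ (v : V) (r : ℕ), 1 ≤ r → r ≤ S.eta v → ∃ N : ℕ, (N : ℝ) ≤ Cσ * S.vol v r ∧
    ∀ w ∈ S.ball v r, S.Floods (Pi.single v N) w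

/-- The mean value property of a single sandpile. -/
def HasMeanValue (S : Sandpile V) (Ch : ℝ) : Prop :=
  ∀ (U : Set V) (p : V → ℝ) (ps : ℝ),
    (∀ u, p u ∈ Set.Icc (0 : ℝ) 1) → ps ∈ Set.Icc (0 : ℝ) 1 →
    (∀ u ∈ U, S.HarmonicAt p ps u) →
    ∀ (v : V) (r : ℕ), 1 ≤ r → r ≤ S.eta v → (∀ u ∈ S.ball v r, u ∈ U) →
      Ch * p v * S.vol v r ≤ ∑ u ∈ S.ball v r, p u

/-- Volume growth of a single sandpile. -/
def HasVolumeGrowth (S : Sandpile V) (α δ Δ : ℝ) : Prop :=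
  ∀ (v : V) (r : ℕ), 1 ≤ r → r ≤ S.eta v →
    δ * (r : ℝ) ^ α ≤ S.vol v r ∧ S.vol v r ≤ Δ * (r : ℝ) ^ α

/-- Overlapping potentials of a single sandpile. -/
def HasOverlap (S : Sandpile V) (f : ℝ → ℝ) : Prop :=
  ∀ (v : V) (r R : ℕ), 1 ≤ r → 1 ≤ R → r ≤ S.eta v → R ≤ S.eta v →
    ∃ h : ℕ, (h : ℝ) ≤ f ((R : ℝ) / (r : ℝ)) ∧ ∀ w ∈ S.ball v R,
      S.Topples (fun u => if u ∈ S.ball v r then h else 0) w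

/-- Since `z` is outside the ball, `hit z` is harmonic on it, and the flooding particles all start
at `v`. -/
theorem sum_ball_hit_le (S : Sandpile V) {Cσ : ℝ} (hLC : S.Conductive Cσ) {v z : V}
    {r : ℕ} (hr : 1 ≤ r) (hrη : r ≤ S.eta v)
    (hz : z ∉ S.ball v r) :
    ∑ x ∈ S.ball v r, S.hit z x ≤ 2 * (Cσ * S.vol v r) * S.hit z v := by
  obtain ⟨N, hN, hfl⟩ := hLC v r hr hrη
  have h1 := S.sum_le_two_mul_of_floods hfl (S.hit_nonneg z) (S.lap_hit_nonneg z)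
    (fun x hx => S.lap_hit z (by rintro rfl; exact hz hx))
  rw [sum_single_mul] at h1
  nlinarith [mul_le_mul_of_nonneg_right hN (S.hit_nonneg z v)]

theorem one_le_mul_hit_of_mem_ball (S : Sandpile V) {Cσ : ℝ} (hLC : S.Conductive Cσ)
    {v z : V} {r : ℕ} (hr : 1 ≤ r) (hrη : r ≤ S.eta v)
    (hz : z ∈ S.ball v r) : 1 ≤ Cσ * S.vol v r * S.hit z v := by
  obtain ⟨N, hN, hfl⟩ := hLC v r hr hrη
  have h1 := S.le_sum_of_floods (hfl z hz) (S.hit_nonneg z) (S.lap_hit_nonneg z)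
  rw [sum_single_mul, hit_self] at h1
  nlinarith [mul_le_mul_of_nonneg_right hN (S.hit_nonneg z v)]

/-- If `z` lies in a ball about `v`, it is hit from `v` with probability of order `1 / |S|`. -/
theorem one_le_size_mul_hit_of_mem_ball (S : Sandpile V) {Cσ Ch : ℝ} (hLC : S.Conductive Cσ)
    (hMV : S.HasMeanValue Ch) (hCσ : 1 ≤ Cσ) (hCh : 0 < Ch) {v z : V} {r : ℕ}
    (hr : 1 ≤ r) (hrη : r ≤ S.eta v)
    (hz : z ∈ S.ball v r) : 1 ≤ Cσ / Ch * S.size * S.hit z v := by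
  have h1 := S.one_le_mul_hit_of_mem_ball hLC hr hrη hz
  -- The constant function `1` turns the mean value property into an upper bound for the volume by
  -- the number of sites.
  have h2 := hMV Set.univ (fun _ => 1) 1 (fun _ => by simp) (by simp)
    (fun u _ => S.harmonicAt_one u) v r hr hrη (fun _ _ => Set.mem_univ _)
  have h3 : Ch * S.vol v r ≤ S.size := by
    refine le_trans (by simpa using h2) ?_
    have := Finset.card_le_univ (S.ball v r)
    unfold size
    exact_mod_cast (by omega)
  have h4 : S.vol v r ≤ S.size / Ch := by
    rw [le_div_iff₀ hCh]
    linarith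
  calc (1 : ℝ) ≤ Cσ * S.vol v r * S.hit z v := h1
    _ ≤ Cσ * (S.size / Ch) * S.hit z v := by
      refine mul_le_mul_of_nonneg_right ?_ (S.hit_nonneg z v)
      exact mul_le_mul_of_nonneg_left h4 (by linarith)
    _ = _ := by ring

/-- Harnack inequality between the centre `v` of a ball of radius `η v` and a point at distance
about half the radius. -/
theorem hit_le_two_mul_hit (S : Sandpile V) {Cσ Ch δ Δ α : ℝ} (hLC : S.Conductive Cσ)
    (hMV : S.HasMeanValue Ch) (hCσ : 1 ≤ Cσ) (hCh : 0 < Ch) (hδ : 0 < δ) (hΔ0 : 0 < Δ) (hα : 0 ≤ α)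
    (hV : S.HasVolumeGrowth α δ Δ) {v w z : V} (hv : 2 ≤ S.eta v) (hz : z ∉ S.ball v (S.eta v))
    (hw : S.graph.dist v w + S.eta v / 2 ≤ S.eta v) :
    S.hit z w ≤ 2 * (Cσ / Ch * (Δ / δ) * 3 ^ α) * S.hit z v := by
  set r := S.eta v with hr
  set s := r / 2 with hs
  have hs1 : 1 ≤ s := by omega
  have hsη : s ≤ S.eta w := by
    have := S.eta_le_dist_add v w
    omega
  have hsub : S.ball w s ⊆ S.ball v r := S.ball_subset_ball hw
  -- The mean value property bounds the value at `w` by the mass over a small ball; this lies in the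
  -- large ball about `v`, whose mass is controlled by flooding from `v`.
  have h1 := S.sum_ball_hit_le hLC (show 1 ≤ r by omega) le_rfl hz
  have h2 := hMV {x | x ≠ z} (S.hit z) 0 (fun u => ⟨S.hit_nonneg z u, S.hit_le_one z u⟩)
    (by simp) (fun u hu => S.harmonicAt_hit hu) w s hs1 hsη
    (fun u hu => by rintro rfl; exact hz (hsub hu))
  have h3 : ∑ u ∈ S.ball w s, S.hit z u ≤ ∑ u ∈ S.ball v r, S.hit z u :=
    Finset.sum_le_sum_of_subset_of_nonneg hsub fun _ _ _ => S.hit_nonneg z _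
  have h4 := (hV v r (by omega) le_rfl).2
  have h5 := (hV w s hs1 hsη).1
  -- For `r ≥ 2` one has `r ≤ 3 * (r / 2)` in integers, with equality at `r = 3`.
  have h6 : (r : ℝ) ^ α ≤ 3 ^ α * (s : ℝ) ^ α := by
    rw [← Real.mul_rpow (by norm_num) (by positivity)]
    refine Real.rpow_le_rpow (by positivity) ?_ hα
    exact_mod_cast (by omega : r ≤ 3 * s)
  have hsα : 0 < (s : ℝ) ^ α := Real.rpow_pos_of_pos (by exact_mod_cast hs1) _
  have p0 := S.hit_nonneg z v
  have q0 := S.hit_nonneg z w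
  have h7 : Ch * S.hit z w * (δ * (s : ℝ) ^ α) ≤
      2 * (Cσ * (Δ * (3 ^ α * (s : ℝ) ^ α))) * S.hit z v := by
    calc Ch * S.hit z w * (δ * (s : ℝ) ^ α) ≤ Ch * S.hit z w * S.vol w s :=
          mul_le_mul_of_nonneg_left h5 (mul_nonneg hCh.le q0)
      _ ≤ 2 * (Cσ * S.vol v r) * S.hit z v := h2.trans (h3.trans h1)
      _ ≤ _ := by
          refine mul_le_mul_of_nonneg_right ?_ p0
          refine mul_le_mul_of_nonneg_left ?_ (by norm_num)
          refine mul_le_mul_of_nonneg_left ?_ (by linarith)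
          exact h4.trans (mul_le_mul_of_nonneg_left h6 hΔ0.le)
  have h8 : S.hit z w * (Ch * δ * (s : ℝ) ^ α) ≤
      (2 * (Cσ / Ch * (Δ / δ) * 3 ^ α) * S.hit z v) * (Ch * δ * (s : ℝ) ^ α) := by
    have : (2 * (Cσ / Ch * (Δ / δ) * 3 ^ α) * S.hit z v) * (Ch * δ * (s : ℝ) ^ α) =
        2 * (Cσ * (Δ * (3 ^ α * (s : ℝ) ^ α))) * S.hit z v := by
      field_simp
    rw [this]
    linarith
  exact le_of_mul_le_mul_right h8 (by positivity)

/-- The mass of the hitting probability over the ball of radius `η v / 4` about `v`. -/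
def quarterMass (S : Sandpile V) (z v : V) : ℝ := ∑ x ∈ S.ball v (S.eta v / 4), S.hit z x

theorem quarterMass_nonneg (S : Sandpile V) (z v : V) : 0 ≤ S.quarterMass z v :=
  Finset.sum_nonneg fun x _ => S.hit_nonneg z x

theorem hit_le_quarterMass (S : Sandpile V) (z v : V) : S.hit z v ≤ S.quarterMass z v :=
  Finset.single_le_sum (fun x _ => S.hit_nonneg z x) (by simp [mem_ball])

theorem sum_ball_indicator_mul (S : Sandpile V) (v : V) (r h : ℕ) (p : V → ℝ) :
    ∑ x, ((if x ∈ S.ball v r then h else 0 : ℕ) : ℝ) * p x = h * ∑ x ∈ S.ball v r, p x := by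
  simp [Finset.mul_sum]

/-- The outer radius is `4 * (η / 4)` instead of `η`, so that the ratio of radii is exactly `4` and
only the value `f 4` enters. -/
theorem one_le_mul_quarterMass (S : Sandpile V) {f : ℝ → ℝ} {H : ℝ} (hOP : S.HasOverlap f)
    (hf : f 4 ≤ H) {v z : V} (hv : 4 ≤ S.eta v)
    (hz : z ∈ S.ball v (4 * (S.eta v / 4))) : 1 ≤ H * S.quarterMass z v := by
  obtain ⟨h, hh, ht⟩ := hOP v (S.eta v / 4) (4 * (S.eta v / 4)) (by omega) (by omega) (by omega)
    (by omega)
  have h1 := S.le_sum_of_floods (ht z hz).floods (S.hit_nonneg z) (S.lap_hit_nonneg z)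
  rw [sum_ball_indicator_mul, hit_self] at h1
  have hne : ((S.eta v / 4 : ℕ) : ℝ) ≠ 0 := by
    exact_mod_cast (by omega : S.eta v / 4 ≠ 0)
  have e : ((4 * (S.eta v / 4) : ℕ) : ℝ) / ((S.eta v / 4 : ℕ) : ℝ) = 4 := by
    push_cast [Nat.cast_mul]
    field_simp
  rw [e] at hh
  exact h1.trans (mul_le_mul_of_nonneg_right (hh.trans hf) (S.quarterMass_nonneg z v))

theorem quarterMass_le (S : Sandpile V) {f : ℝ → ℝ} {H : ℝ} (hOP : S.HasOverlap f)
    (hf : f 4 ≤ H) {v w z : V} (hv : 4 ≤ S.eta v)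
    (hz : z ∉ S.ball v (4 * (S.eta v / 4))) (hw : S.graph.dist v w ≤ 2 * (S.eta v / 4)) :
    S.quarterMass z w ≤ 2 * H * S.quarterMass z v := by
  obtain ⟨h, hh, ht⟩ := hOP v (S.eta v / 4) (4 * (S.eta v / 4)) (by omega) (by omega) (by omega)
    (by omega)
  have h1 := S.sum_le_two_mul_of_floods (fun x hx => (ht x hx).floods) (S.hit_nonneg z)
    (S.lap_hit_nonneg z) (fun x hx => S.lap_hit z (by rintro rfl; exact hz hx))
  rw [sum_ball_indicator_mul] at h1
  have hne : ((S.eta v / 4 : ℕ) : ℝ) ≠ 0 := by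
    exact_mod_cast (by omega : S.eta v / 4 ≠ 0)
  have e : ((4 * (S.eta v / 4) : ℕ) : ℝ) / ((S.eta v / 4 : ℕ) : ℝ) = 4 := by
    push_cast [Nat.cast_mul]
    field_simp
  rw [e] at hh
  -- With `r = η v / 4 ≥ 1`, `η w ≤ 6 * r + 3`, hence `η w / 4 ≤ 2 * r`; the other `2 * r` is the
  -- distance to `w`.
  have hsub : S.ball w (S.eta w / 4) ⊆ S.ball v (4 * (S.eta v / 4)) := by
    refine S.ball_subset_ball ?_
    have h2 := S.eta_le_dist_add w v
    rw [SimpleGraph.dist_comm] at h2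
    omega
  have h3 : S.quarterMass z w ≤ ∑ x ∈ S.ball v (4 * (S.eta v / 4)), S.hit z x :=
    Finset.sum_le_sum_of_subset_of_nonneg hsub fun _ _ _ => S.hit_nonneg z _
  have h4 := mul_le_mul_of_nonneg_right (hh.trans hf) (S.quarterMass_nonneg z v)
  unfold quarterMass at h3 h4 ⊢
  linarith

/-- The passage from a mass back to the value at the centre. It is made once per linear piece, so
the crude volume bound does no harm; the second alternative covers a ball containing `z`. -/
theorem quarterMass_le_of_conductance (S : Sandpile V) {Cσ Δ : ℝ}
    (hLC : S.Conductive Cσ) (hΔ : ∀ v, (S.deg v : ℝ) ≤ Δ) (hCσ : 0 ≤ Cσ) {v z : V}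
    (hv : 4 ≤ S.eta v) :
    S.quarterMass z v ≤ 2 * (Cσ * (Δ * S.size)) * S.hit z v ∨
      1 ≤ Cσ * (Δ * S.size) * S.hit z v := by
  have h0 := S.vol_le hΔ v (S.eta v / 4)
  have h1 := mul_le_mul_of_nonneg_left h0 hCσ
  have h2 := mul_le_mul_of_nonneg_right h1 (S.hit_nonneg z v)
  by_cases hz : z ∈ S.ball v (S.eta v / 4)
  · right
    exact (S.one_le_mul_hit_of_mem_ball hLC (by omega) (by omega) hz).trans h2
  · left
    have := S.sum_ball_hit_le hLC (show 1 ≤ S.eta v / 4 by omega) (by omega) hz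
    unfold quarterMass
    nlinarith

end

end Sandpile

/-! ### Chains of comparisons along a linear profile -/

/-- Hops along an increasing linear profile `g`: as long as `g` exceeds the threshold `gs`, either
`F * q j ≥ 1`, or a hop whose length is at least `θ * g j` loses a factor `Y`.  The number of hops
is logarithmic. -/
theorem exists_ascending_chain {L : ℕ} {g q : ℕ → ℝ} {b θ gs N κ Y F : ℝ} (hb : 0 ≤ b)
    (hθ : 0 ≤ θ) (hκ : 0 ≤ κ) (hY : 0 ≤ Y) (hF : 0 ≤ F)
    (hg : ∀ j d : ℕ, g (j + d) = g j + b * d)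
    (hop : ∀ j ≤ L, gs < g j → 1 ≤ F * q j ∨ (κ * g j ≤ N ∧ ∃ d : ℕ, 1 ≤ d ∧ j + d ≤ L ∧
      θ * g j ≤ d ∧ q (j + d) ≤ Y * q j)) (j : ℕ) (hj : j ≤ L) (hgj : gs < g j) :
    ∃ m : ℕ, 1 ≤ F * Y ^ m * q j ∧ (1 ≤ m → κ * (1 + b * θ) ^ (m - 1) * g j ≤ N) ∧
      (2 ≤ m → κ * (1 + b * θ) ^ (m - 2) * (g j + b) ≤ N) := by
  obtain ⟨k, hk⟩ : ∃ k, L - j = k := ⟨_, rfl⟩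
  induction k using Nat.strong_induction_on generalizing j with
  | _ k ih =>
    rcases hop j hj hgj with h | ⟨hN, d, hd, hjd, hθd, hq⟩
    · exact ⟨0, by simpa using h, by simp, by simp⟩
    · have h1 : g j + b ≤ g (j + d) := by
        rw [hg]
        have : (1 : ℝ) ≤ d := by exact_mod_cast hd
        nlinarith
      have h2 : (1 + b * θ) * g j ≤ g (j + d) := by
        rw [hg]
        nlinarith [mul_le_mul_of_nonneg_left hθd hb]
      obtain ⟨m, i1, i2, -⟩ := ih (L - (j + d)) (by omega) (j + d) hjd (by linarith) rfl
      have hpos : 0 ≤ 1 + b * θ := by positivity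
      refine ⟨m + 1, ?_, fun _ => ?_, fun hm => ?_⟩
      · calc (1 : ℝ) ≤ F * Y ^ m * q (j + d) := i1
          _ ≤ F * Y ^ m * (Y * q j) := mul_le_mul_of_nonneg_left hq (by positivity)
          _ = F * Y ^ (m + 1) * q j := by ring
      · rcases Nat.eq_zero_or_pos m with rfl | hm
        · simpa using hN
        · obtain ⟨m, rfl⟩ : ∃ k, m = k + 1 := ⟨m - 1, by omega⟩
          refine le_trans ?_ (i2 hm)
          simp only [Nat.add_sub_cancel]
          calc κ * (1 + b * θ) ^ (m + 1) * g j = κ * (1 + b * θ) ^ m * ((1 + b * θ) * g j) := by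
                ring
            _ ≤ _ := mul_le_mul_of_nonneg_left h2 (by positivity)
      · refine le_trans ?_ (i2 (by omega))
        have : m + 1 - 2 = m - 1 := by omega
        rw [this]
        exact mul_le_mul_of_nonneg_left h1 (by positivity)

/-- A lower bound for the height from which `m` hops descend. -/
noncomputable def descentHeight (b θ : ℝ) : ℕ → ℝ
  | 0 => 1
  | m + 1 => (1 + b) / (1 - b * θ) ^ m

/-- The lowest hop lands at height at least `1` and is credited only with the drop `b`; each earlier
one contributes a factor `(1 - b * θ)⁻¹`. -/
theorem descentHeight_succ_le {b θ x y : ℝ} (hbθ : b * θ < 1) (hy : 1 ≤ y) (h1 : y + b ≤ x)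
    (h2 : y ≤ x * (1 - b * θ)) {m : ℕ} (h : descentHeight b θ m ≤ y) :
    descentHeight b θ (m + 1) ≤ x := by
  have hpos : 0 < 1 - b * θ := by linarith
  cases m with
  | zero => simp only [descentHeight, pow_zero, div_one]; linarith
  | succ m =>
    simp only [descentHeight] at h ⊢
    rw [pow_succ, ← div_div, div_le_iff₀ hpos]
    exact h.trans h2

/-- Hops along a decreasing linear profile. -/
theorem exists_descending_chain {L : ℕ} {g q : ℕ → ℝ} {b θ gs Y F : ℝ} (hb : 0 ≤ b)
    (hbθ : b * θ < 1) (hgs : 1 ≤ gs) (hY : 0 ≤ Y) (hF : 0 ≤ F)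
    (hg : ∀ j d : ℕ, g (j + d) = g j - b * d)
    (hop : ∀ j ≤ L, gs < g j → 1 ≤ F * q j ∨ ∃ d : ℕ, 1 ≤ d ∧ j + d ≤ L ∧
      θ * g j ≤ d ∧ q (j + d) ≤ Y * q j) (j : ℕ) (hj : j ≤ L) (hgj : gs < g j) :
    ∃ m : ℕ, (1 ≤ F * Y ^ m * q j ∧ descentHeight b θ m ≤ g j) ∨
      (1 ≤ m ∧ descentHeight b θ (m - 1) ≤ g j ∧
        ∃ i, j ≤ i ∧ i ≤ L ∧ g i ≤ gs ∧ q i ≤ Y ^ m * q j) := by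
  obtain ⟨k, hk⟩ : ∃ k, L - j = k := ⟨_, rfl⟩
  induction k using Nat.strong_induction_on generalizing j with
  | _ k ih =>
    rcases hop j hj hgj with h | ⟨d, hd, hjd, hθd, hq⟩
    · exact ⟨0, Or.inl ⟨by simpa using h, by simp only [descentHeight]; linarith⟩⟩
    · have h1 : g (j + d) + b ≤ g j := by
        rw [hg]
        have : (1 : ℝ) ≤ d := by exact_mod_cast hd
        nlinarith
      have h2 : g (j + d) ≤ g j * (1 - b * θ) := by
        rw [hg]
        nlinarith [mul_le_mul_of_nonneg_left hθd hb]
      by_cases hs : g (j + d) ≤ gs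
      · exact ⟨1, Or.inr ⟨le_rfl, by simp only [descentHeight]; linarith,
          j + d, by omega, hjd, hs, by simpa using hq⟩⟩
      · push Not at hs
        obtain ⟨m, h⟩ := ih (L - (j + d)) (by omega) (j + d) hjd hs rfl
        refine ⟨m + 1, ?_⟩
        rcases h with ⟨i1, i2⟩ | ⟨i0, i1, i, i2, i3, i4, i5⟩
        · refine Or.inl ⟨?_, descentHeight_succ_le hbθ (by linarith) h1 h2 i2⟩
          calc (1 : ℝ) ≤ F * Y ^ m * q (j + d) := i1
            _ ≤ F * Y ^ m * (Y * q j) := mul_le_mul_of_nonneg_left hq (by positivity)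
            _ = F * Y ^ (m + 1) * q j := by ring
        · have h3 := descentHeight_succ_le hbθ (by linarith) h1 h2 i1
          rw [Nat.sub_add_cancel i0] at h3
          refine Or.inr ⟨by omega, h3, i, by omega, i3, i4, i5.trans ?_⟩
          calc Y ^ m * q (j + d) ≤ Y ^ m * (Y * q j) :=
                mul_le_mul_of_nonneg_left hq (by positivity)
            _ = Y ^ (m + 1) * q j := by ring

/-- Since `(1 + b / 2) * (1 - b / 2) ≤ 1`, decay is at least as fast as growth. The factor `1 + b`
pays for the two surplus powers, because `(1 + b / 2) ^ 2 * (1 - b ^ 2 / 4) ≤ 1 + b`. -/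
theorem one_add_half_pow_le {b N : ℝ} (hb : 0 < b) (hb1 : b ≤ 1) (hN : 9 / 4 ≤ N) {m : ℕ}
    (h : descentHeight b (1 / 2) m ≤ N) : (1 + b / 2) ^ (m + 1) ≤ N := by
  have hp : 0 ≤ 1 + b / 2 := by linarith
  rcases m with _ | _ | k
  · simp only [zero_add, pow_one]; linarith
  · refine le_trans ?_ hN
    nlinarith
  · refine le_trans ?_ h
    simp only [descentHeight]
    have hpos : 0 < 1 - b * (1 / 2) := by linarith
    rw [le_div_iff₀ (by positivity)]
    have h1 : (1 + b / 2) ^ (k + 1 + 1 + 1) * (1 - b * (1 / 2)) ^ (k + 1) =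
        (1 + b / 2) ^ 2 * ((1 - b ^ 2 / 4) ^ (k + 1)) := by
      rw [show 1 - b ^ 2 / 4 = (1 + b / 2) * (1 - b * (1 / 2)) by ring, mul_pow]
      ring
    rw [h1]
    have h2 : (1 - b ^ 2 / 4) ^ (k + 1) ≤ 1 - b ^ 2 / 4 := by
      refine pow_le_of_le_one ?_ ?_ (by omega) <;> nlinarith
    have h3 : (1 + b / 2) ^ 2 * (1 - b ^ 2 / 4) ≤ 1 + b := by
      nlinarith [pow_pos hb 3, pow_pos hb 4]
    exact (mul_le_mul_of_nonneg_left h2 (by positivity)).trans h3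

/-! ### Numerical estimates -/

namespace Real

theorem log_one_add_le_cubic {x : ℝ} (hx : 0 ≤ x) : log (1 + x) ≤ x - x ^ 2 / 2 + x ^ 3 / 3 := by
  have hd : ∀ y ∈ interior (Set.Ici (0 : ℝ)),
      HasDerivAt (fun y : ℝ => y - y ^ 2 / 2 + y ^ 3 / 3 - log (1 + y))
        (1 - y + y ^ 2 - 1 / (1 + y)) y := by
    intro y hy
    rw [interior_Ici] at hy
    have hy' : (0 : ℝ) < 1 + y := by linarith [Set.mem_Ioi.1 hy]
    have h1 := ((hasDerivAt_id y).const_add 1).log hy'.ne'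
    have h2 := (((hasDerivAt_id y).sub ((hasDerivAt_pow 2 y).div_const 2)).add
      ((hasDerivAt_pow 3 y).div_const 3)).sub h1
    refine h2.congr_deriv ?_
    simp only [id]
    push_cast
    ring
  have hm : MonotoneOn (fun y : ℝ => y - y ^ 2 / 2 + y ^ 3 / 3 - log (1 + y)) (Set.Ici 0) := by
    refine monotoneOn_of_deriv_nonneg (convex_Ici 0) ?_
      (fun y hy => (hd y hy).differentiableAt.differentiableWithinAt) ?_
    · refine ContinuousOn.sub (by fun_prop) (ContinuousOn.log (by fun_prop) fun y hy => ?_)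
      have : (0 : ℝ) ≤ y := hy
      linarith
    · intro y hy
      rw [(hd y hy).deriv]
      rw [interior_Ici] at hy
      have hy0 : (0 : ℝ) < y := hy
      have hy' : (0 : ℝ) < 1 + y := by linarith
      have : 1 - y + y ^ 2 - 1 / (1 + y) = y ^ 3 / (1 + y) := by
        field_simp
        ring
      rw [this]
      positivity
  have := hm (Set.mem_Ici.2 le_rfl) (Set.mem_Ici.2 hx) hx
  simp at this
  linarith

theorem log_three_lt_d4 : log 3 < 1.0989 := by
  have h : (41 : ℕ) * log 3 < (65 : ℕ) * log 2 := by
    rw [← log_pow, ← log_pow]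
    exact log_lt_log (by norm_num) (by norm_num)
  have := log_two_lt_d9
  push_cast at h
  linarith

theorem log_five_lt_d2 : log 5 < 1.61 := by
  have h : (31 : ℕ) * log 5 < (72 : ℕ) * log 2 := by
    rw [← log_pow, ← log_pow]
    exact log_lt_log (by norm_num) (by norm_num)
  have := log_two_lt_d9
  push_cast at h
  linarith

theorem log_seven_gt_d4 : 1.9452 < log 7 := by
  have h : (87 : ℕ) * log 2 < (31 : ℕ) * log 7 := by
    rw [← log_pow, ← log_pow]
    exact log_lt_log (by norm_num) (by norm_num)
  have := log_two_gt_d9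
  push_cast at h
  linarith

theorem mul_log_le_log_one_add_mul {s p : ℝ} (hs : 0 ≤ s) (hp : 0 ≤ p) (hp1 : p ≤ 1) :
    p * log (1 + s) ≤ log (1 + p * s) := by
  rw [← log_rpow (by linarith)]
  exact log_le_log (by positivity) (rpow_one_add_le_one_add_mul_self (by linarith) hp hp1)

theorem log_one_add_mul_le {s p : ℝ} (hs : 0 ≤ s) (hp : 1 ≤ p) :
    log (1 + p * s) ≤ p * log (1 + s) := by
  rw [← log_rpow (by linarith)]
  exact log_le_log (by positivity) (one_add_mul_self_le_rpow_one_add (by linarith) hp)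

end Real

section Estimates

open Real

/-- Bernoulli with exponent `4 / 3`, tangent at `Δ = 3`. It reduces the cost estimates to that
extreme case. -/
theorem log_sub_log_three_le {Δ : ℝ} (hΔ : 3 ≤ Δ) :
    log Δ ≤ log 3 + 4 / 3 * (log (Δ + 1) - 2 * log 2) := by
  have h := log_one_add_mul_le (s := (Δ - 3) / 4) (p := 4 / 3) (by linarith) (by norm_num)
  have e1 : 1 + 4 / 3 * ((Δ - 3) / 4) = Δ / 3 := by ring
  have e2 : 1 + (Δ - 3) / 4 = (Δ + 1) / 2 ^ 2 := by ring
  rw [e1, e2, log_div (by linarith) (by norm_num), log_div (by linarith) (by norm_num),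
    log_pow] at h
  push_cast at h
  linarith

theorem two_mul_log_two_le {Δ : ℝ} (hΔ : 3 ≤ Δ) : 2 * log 2 ≤ log (Δ + 1) := by
  have : (2 : ℕ) * log 2 ≤ log (Δ + 1) := by
    rw [← log_pow]
    exact log_le_log (by norm_num) (by linarith)
  exact_mod_cast this

/-- Both sides are affine in `y`, so the endpoints `0` and `1` suffice. The decimals stand for `log
3`, `log 7 + log 2`, `log 2`, `log 7`, `log 5` and `log 2 ^ 2`. -/
theorem ascending_profile_le {b y : ℝ} (hb : 0 ≤ b) (hb1 : b ≤ 1) (y0 : 0 ≤ y) (y1 : y ≤ 1) :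
    (1 / 2 - b / 8 + b ^ 2 / 24) * (2 + b * y) * 1.0989 +
      (1 / 2 - b / 8 + b ^ 2 / 24) * b * 2.6384 ≤
    0.6931 * (2 * 1.9452 - 1.61) + (1 + y) * b * 0.4803 := by
  have b2 : b ^ 2 ≤ b := by nlinarith
  have b3 : 0 ≤ b ^ 2 := sq_nonneg b
  have b4 : b ^ 3 ≤ b ^ 2 := by nlinarith
  have e0 : 0 ≤ (0.6931 : ℝ) * (2 * 1.9452 - 1.61) + b * 0.4803 -
      (1 / 2 - b / 8 + b ^ 2 / 24) * 2 * 1.0989 -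
      (1 / 2 - b / 8 + b ^ 2 / 24) * b * 2.6384 := by
    nlinarith [sq_nonneg (1 - b), mul_nonneg hb (sq_nonneg (1 - b))]
  have e1 : 0 ≤ (0.6931 : ℝ) * (2 * 1.9452 - 1.61) + 2 * b * 0.4803 -
      (1 / 2 - b / 8 + b ^ 2 / 24) * (2 + b) * 1.0989 -
      (1 / 2 - b / 8 + b ^ 2 / 24) * b * 2.6384 := by
    nlinarith [sq_nonneg (1 - b), mul_nonneg hb (sq_nonneg (1 - b))]
  have e2 := mul_nonneg (show 0 ≤ 1 - y by linarith) e0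
  have e3 := mul_nonneg y0 e1
  linarith only [e2, e3]

theorem log_one_add_half_le {b : ℝ} (hb : 0 ≤ b) :
    log (1 + b / 2) ≤ (1 / 2 - b / 8 + b ^ 2 / 24) * b := by
  have := log_one_add_le_cubic (x := b / 2) (by linarith)
  linarith

/-- The cost of `t` single steps and `m` hops along an increasing profile. -/
theorem ascending_cost_le {b Δ g n : ℝ} {t m : ℕ} (hb : 0 < b) (hb1 : b ≤ 1) (hΔ : 3 ≤ Δ)
    (hn : 7 ≤ n) (hg : 1 < g) (ht : b * t ≤ 1 + g) (htg : 1 ≤ t → g ≤ 1 + b)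
    (hm : 1 ≤ m → (1 + b) * (1 + b / 2) ^ (m - 1) * g ≤ n - 2) :
    t * log Δ + m * log 2 + log n ≤ log (Δ + 1) * (log n / log (1 + b / 2)) := by
  set ℓ := log (1 + b / 2) with hℓ
  have ℓ0 : 0 < ℓ := log_pos (by linarith)
  have hlt := log_two_lt_d9
  have hgt := log_two_gt_d9
  have h3 := log_three_lt_d4
  have h5 := log_five_lt_d2
  have h7 := log_seven_gt_d4
  have hE := two_mul_log_two_le hΔ
  have hD := log_sub_log_three_le hΔ
  have hD0 : 0 ≤ log Δ := log_nonneg (by linarith)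
  have hν : log 7 ≤ log n := log_le_log (by norm_num) hn
  set K := ℓ / b with hK
  have hKℓ : ℓ = K * b := by rw [hK]; field_simp
  have K0 : 0 < K := by positivity
  have hKle : K ≤ 1 / 2 - b / 8 + b ^ 2 / 24 := by
    rw [hK, div_le_iff₀ hb]
    exact log_one_add_half_le hb.le
  have hℓ15 : ℓ ≤ 0.4059 := by
    have h1 : ℓ ≤ log (3 / 2) := log_le_log (by linarith) (by linarith)
    rw [log_div (by norm_num) (by norm_num)] at h1
    linarith
  have hK2 : K * (2 + b) ≤ 1.25 := by
    have : (1 / 2 - b / 8 + b ^ 2 / 24) * (2 + b) ≤ 1.25 := by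
      nlinarith only [sq_nonneg b, hb, hb1, mul_nonneg hb.le (sq_nonneg (1 - b)),
        mul_nonneg hb.le (show 0 ≤ 1 - b by linarith only [hb1])]
    exact (mul_le_mul_of_nonneg_right hKle (by linarith)).trans this
  -- When there are single steps, `g = 1 + b * y`: `y` is the fraction of a step by which the
  -- profile overshoots the threshold. By concavity of the logarithm the overshoot also raises `log
  -- g`, which saves hops.
  obtain ⟨y, y0, y1, hty, hgy⟩ : ∃ y : ℝ, 0 ≤ y ∧ y ≤ 1 ∧ ℓ * t ≤ K * (2 + b * y) ∧
      y * log (1 + b) ≤ log g := by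
    rcases Nat.eq_zero_or_pos t with rfl | ht0
    · exact ⟨0, le_rfl, zero_le_one, by simp; positivity, by simpa using log_nonneg hg.le⟩
    · have hg1 := htg ht0
      refine ⟨(g - 1) / b, div_nonneg (by linarith) hb.le, (div_le_one hb).2 (by linarith), ?_, ?_⟩
      · rw [hKℓ, mul_div_cancel₀ _ hb.ne']
        nlinarith
      · have := mul_log_le_log_one_add_mul (s := b) (p := (g - 1) / b) hb.le
          (div_nonneg (by linarith) hb.le) ((div_le_one hb).2 (by linarith))
        rwa [div_mul_cancel₀ _ hb.ne', add_sub_cancel] at this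
  have hlam : b * log 2 ≤ log (1 + b) := by
    have := mul_log_le_log_one_add_mul (s := 1) (p := b) zero_le_one hb.le hb1
    rw [mul_one] at this
    convert this using 3
    norm_num
  have hlog2 : 0 < log 2 := by linarith
  have hKby : K * (2 + b * y) ≤ K * (2 + b) := by
    refine mul_le_mul_of_nonneg_left ?_ K0.le
    nlinarith
  have hT : ℓ * (t * log Δ) ≤ K * (2 + b * y) * log Δ := by
    calc ℓ * (t * log Δ) = ℓ * t * log Δ := by ring
      _ ≤ _ := mul_le_mul_of_nonneg_right hty hD0
  have hsuff : ℓ * (t * log Δ + m * log 2 + log n) ≤ log (Δ + 1) * log n := by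
    rcases Nat.eq_zero_or_pos m with rfl | hm0
    · have h1 : log Δ ≤ log (Δ + 1) := log_le_log (by linarith) (by linarith)
      have h2 : K * (2 + b * y) * log Δ ≤ 1.25 * log (Δ + 1) :=
        mul_le_mul (hKby.trans hK2) h1 hD0 (by norm_num)
      have h4 : ℓ * log n ≤ 0.4059 * log n := mul_le_mul_of_nonneg_right hℓ15 (by linarith)
      have h6 : log (Δ + 1) * 1.9452 ≤ log (Δ + 1) * log n :=
        mul_le_mul_of_nonneg_left (by linarith only [h7, hν]) (by linarith only [hE, hgt])
      have h8 : 1.386 * (log n - 1.9452) ≤ log (Δ + 1) * (log n - 1.9452) :=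
        mul_le_mul_of_nonneg_right (by linarith only [hE, hgt]) (by linarith only [h7, hν])
      simp only [Nat.cast_zero, zero_mul, add_zero]
      linarith only [hT, h2, h4, h6, h8, hE, hgt, h7, hν]
    -- The tangent at `n = 7` to `log (n - 2)` as a function of `log n`, again by Bernoulli.
    · have hM : log (n - 2) ≤ log 5 + 7 / 5 * (log n - log 7) := by
        have h := log_one_add_mul_le (s := (n - 7) / 7) (p := 7 / 5) (by linarith) (by norm_num)
        have e1 : 1 + 7 / 5 * ((n - 7) / 7) = (n - 2) / 5 := by ring
        have e2 : 1 + (n - 7) / 7 = n / 7 := by ring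
        rw [e1, e2, log_div (by linarith) (by norm_num), log_div (by linarith) (by norm_num)] at h
        linarith
      have hmℓ : ℓ * m ≤ log (n - 2) - log (1 + b) - log g + ℓ := by
        have h1 := log_le_log (by positivity) (hm hm0)
        rw [log_mul (by positivity) (by positivity), log_mul (by positivity) (by positivity),
          log_pow, ← hℓ, Nat.cast_sub hm0] at h1
        push_cast at h1
        linarith
      have hmy : ℓ * m ≤ log (n - 2) - (1 + y) * (b * log 2) + ℓ := by
        have := mul_le_mul_of_nonneg_left hlam (show 0 ≤ 1 + y by linarith)
        linarith
      -- reduction to `Δ = 3`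
      have hred : K * (2 + b * y) * log Δ + 2 * log 2 * log n ≤
          K * (2 + b * y) * log 3 + log (Δ + 1) * log n := by
        have h1 : K * (2 + b * y) ≤ 1.25 := hKby.trans hK2
        have h2 : 0 ≤ K * (2 + b * y) := by positivity
        have h4 := mul_le_mul_of_nonneg_left hD h2
        have h6 : 0 ≤ (log (Δ + 1) - 2 * log 2) * (log n - 4 / 3 * (K * (2 + b * y))) :=
          mul_nonneg (by linarith only [hE]) (by linarith only [h1, h7, hν])
        linarith only [h4, h6]
      have hn2 : log 2 * (ℓ * m) ≤ log 2 * (1.61 + 7 / 5 * (log n - 1.9452) -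
          (1 + y) * (b * log 2) + ℓ) := by
        refine mul_le_mul_of_nonneg_left ?_ hlog2.le
        linarith only [hmy, hM, h5, h7]
      have hν' : 0 ≤ (3 / 5 * log 2 - ℓ) * (log n - 1.9452) :=
        mul_nonneg (by linarith only [hgt, hℓ15]) (by linarith only [h7, hν])
      -- the remaining inequality in `b` and `y`
      have hsq : 0.4803 ≤ log 2 * log 2 := by nlinarith only [hgt]
      have hfin : K * (2 + b * y) * log 3 + ℓ * (1.9452 + log 2) ≤
          log 2 * (2 * 1.9452 - 1.61) + (1 + y) * b * (log 2 * log 2) := by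
        have hquad : 0 ≤ 1 / 2 - b / 8 + b ^ 2 / 24 := K0.le.trans hKle
        have k1 : K * (2 + b * y) * log 3 ≤ (1 / 2 - b / 8 + b ^ 2 / 24) * (2 + b * y) * 1.0989 :=
          mul_le_mul (mul_le_mul_of_nonneg_right hKle (by positivity)) h3.le
            (log_nonneg (by norm_num)) (mul_nonneg hquad (by positivity))
        have k2 : ℓ * (1.9452 + log 2) ≤ (1 / 2 - b / 8 + b ^ 2 / 24) * b * 2.6384 := by
          rw [hKℓ]
          exact mul_le_mul (mul_le_mul_of_nonneg_right hKle hb.le) (by linarith) (by linarith)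
            (mul_nonneg hquad hb.le)
        have k3 : (1 + y) * b * 0.4803 ≤ (1 + y) * b * (log 2 * log 2) :=
          mul_le_mul_of_nonneg_left hsq (by positivity)
        have k4 : (0.6931 : ℝ) * (2 * 1.9452 - 1.61) ≤ log 2 * (2 * 1.9452 - 1.61) :=
          mul_le_mul_of_nonneg_right (by linarith) (by norm_num)
        have k5 := ascending_profile_le hb.le hb1 y0 y1
        linarith only [k1, k2, k3, k4, k5]
      linarith only [hT, hred, hn2, hν', hfin]
  rw [mul_div_assoc', le_div_iff₀ ℓ0]
  linarith

/-- The cost of `m` hops and `t` single steps along a decreasing profile. -/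
theorem descending_cost_le {b Δ n : ℝ} {t m : ℕ} (hb : 0 < b) (hb1 : b ≤ 1) (hΔ : 3 ≤ Δ)
    (hn : 7 ≤ n) (hbn : 1 / 2 ≤ b ∨ 9 ≤ n) (ht : b * t ≤ 3) (hm : (1 + b / 2) ^ m ≤ n - 2) :
    t * log Δ + m * log 2 ≤ log (Δ + 1) * (log n / log (1 + b / 2)) := by
  set ℓ := log (1 + b / 2) with hℓ
  have ℓ0 : 0 < ℓ := log_pos (by linarith)
  have hlt := log_two_lt_d9
  have hgt := log_two_gt_d9
  have h3 := log_three_lt_d4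
  have h7 := log_seven_gt_d4
  have hE := two_mul_log_two_le hΔ
  have hD := log_sub_log_three_le hΔ
  have hD0 : 0 ≤ log Δ := log_nonneg (by linarith)
  have hν : log 7 ≤ log n := log_le_log (by norm_num) hn
  set K := ℓ / b with hK
  have hKℓ : ℓ = K * b := by rw [hK]; field_simp
  have K0 : 0 < K := by positivity
  have hKle : K ≤ 1 / 2 - b / 8 + b ^ 2 / 24 := by
    rw [hK, div_le_iff₀ hb]
    exact log_one_add_half_le hb.le
  have hlog2 : 0 < log 2 := by linarith
  have hmℓ : ℓ * m ≤ log (n - 2) := by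
    have h1 := log_le_log (by positivity) hm
    rw [log_pow, ← hℓ] at h1
    linarith
  have hT : ℓ * (t * log Δ) ≤ 3 * K * log Δ := by
    calc ℓ * (t * log Δ) = K * (b * t) * log Δ := by rw [hKℓ]; ring
      _ ≤ K * 3 * log Δ := mul_le_mul_of_nonneg_right
          (mul_le_mul_of_nonneg_left ht K0.le) hD0
      _ = _ := by ring
  have hM2 : log 2 * (ℓ * m) ≤ log 2 * log (n - 2) := mul_le_mul_of_nonneg_left hmℓ hlog2.le
  -- The cubic bound for `ℓ / b` decreases in `b` and is below `0.448` at `b = 1 / 2`. For smaller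
  -- `b` only `1 / 2` is available, and `n ≥ 9` makes up for it.
  obtain ⟨κ, hKκ, hκν, hκM⟩ : ∃ κ : ℝ, K ≤ κ ∧ 4 * κ ≤ log n ∧
      3 * κ * log 3 ≤ log 2 * (2 * log n - log (n - 2)) := by
    rcases hbn with hb2 | hn9
    · refine ⟨0.448, hKle.trans (by nlinarith), by linarith, ?_⟩
      have h1 : 13 / 4 * log 2 ≤ 2 * log n - log (n - 2) := by
        have h2 : (13 : ℕ) * log 2 ≤ (4 : ℕ) * log (n ^ 2 / (n - 2)) := by
          rw [← log_pow, ← log_pow]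
          refine log_le_log (by norm_num) ?_
          have : (49 / 5 : ℝ) ≤ n ^ 2 / (n - 2) := by
            rw [le_div_iff₀ (by linarith)]
            nlinarith
          calc ((2 : ℝ) ^ 13) ≤ (49 / 5) ^ 4 := by norm_num
            _ ≤ _ := pow_le_pow_left₀ (by norm_num) this 4
        rw [log_div (by positivity) (by linarith), log_pow] at h2
        push_cast at h2
        linarith
      nlinarith
    · refine ⟨1 / 2, hKle.trans (by nlinarith), ?_, ?_⟩
      · have : (3 : ℕ) * log 2 ≤ log n := by
          rw [← log_pow]
          exact log_le_log (by norm_num) (by linarith)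
        push_cast at this
        linarith
      have h1 : 7 / 2 * log 2 ≤ 2 * log n - log (n - 2) := by
        have h2 : (7 : ℕ) * log 2 ≤ (2 : ℕ) * log (n ^ 2 / (n - 2)) := by
          rw [← log_pow, ← log_pow]
          refine log_le_log (by norm_num) ?_
          have : (81 / 7 : ℝ) ≤ n ^ 2 / (n - 2) := by
            rw [le_div_iff₀ (by linarith)]
            nlinarith
          calc ((2 : ℝ) ^ 7) ≤ (81 / 7) ^ 2 := by norm_num
            _ ≤ _ := pow_le_pow_left₀ (by norm_num) this 2
        rw [log_div (by positivity) (by linarith), log_pow] at h2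
        push_cast at h2
        linarith
      nlinarith
  have hred : 3 * κ * log Δ + 2 * log 2 * log n ≤ 3 * κ * log 3 + log (Δ + 1) * log n := by
    have h4 := mul_le_mul_of_nonneg_left hD (show 0 ≤ 3 * κ by linarith)
    have h6 : 0 ≤ (log (Δ + 1) - 2 * log 2) * (log n - 4 * κ) :=
      mul_nonneg (by linarith) (by linarith)
    nlinarith
  have hKD : 3 * K * log Δ ≤ 3 * κ * log Δ := mul_le_mul_of_nonneg_right (by linarith) hD0
  rw [mul_div_assoc', le_div_iff₀ ℓ0]
  nlinarith

/-- Per unit of `log n / ℓ`, the hops cost `log 2` and the factor `n` costs `ℓ ≤ log (3 / 2)`,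
together at most `log 3`. -/
theorem trigger_cost_le {b Δ n : ℝ} {m : ℕ} (hb : 0 < b) (hb1 : b ≤ 1) (hΔ : 3 ≤ Δ)
    (hn : 1 ≤ n) (hm : (m + 1 : ℝ) ≤ log n / log (1 + b / 2)) :
    m * log 2 + log n ≤ log (Δ + 1) * (log n / log (1 + b / 2)) := by
  set ℓ := log (1 + b / 2) with hℓ
  have ℓ0 : 0 < ℓ := log_pos (by linarith)
  have hℓ15 : ℓ ≤ log 3 - log 2 := by
    rw [← log_div (by norm_num) (by norm_num)]
    exact log_le_log (by linarith) (by linarith)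
  have h4 : log 3 ≤ log (Δ + 1) := log_le_log (by norm_num) (by linarith)
  have hν : 0 ≤ log n := log_nonneg hn
  have h2 : 0 < log 2 := log_pos (by norm_num)
  rw [le_div_iff₀ ℓ0] at hm
  rw [mul_div_assoc', le_div_iff₀ ℓ0]
  nlinarith [mul_le_mul_of_nonneg_right h4 hν, mul_le_mul_of_nonneg_right hℓ15 hν,
    mul_le_mul_of_nonneg_left hm h2.le]

theorem natCast_le_log_div {b n : ℝ} {m : ℕ} (hb : 0 < b) (h : (1 + b / 2) ^ m ≤ n) :
    (m : ℝ) ≤ log n / log (1 + b / 2) := by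
  rw [le_div_iff₀ (log_pos (by linarith)), ← log_pow]
  exact log_le_log (by positivity) h

theorem one_add_half_pow_le_of_small {b : ℝ} (hb : 0 < b) (hb1 : b ≤ 1) {n : ℕ} (hn : 2 ≤ n)
    (h : n ≤ 6 ∨ (n ≤ 8 ∧ b < 1 / 2)) : (1 + b / 2) ^ (n - 2) ≤ (n : ℝ) := by
  have h0 : 0 ≤ 1 + b / 2 := by linarith
  rcases h with h | ⟨h, hb2⟩
  · refine (pow_le_pow_left₀ h0 (show 1 + b / 2 ≤ 3 / 2 by linarith) _).trans ?_
    interval_cases n <;> norm_num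
  · refine (pow_le_pow_left₀ h0 (show 1 + b / 2 ≤ 5 / 4 by linarith) _).trans ?_
    interval_cases n <;> norm_num

/-- The power is at most `exp (b * t / 2) ≤ exp (3 / 2) < 7`. -/
theorem one_add_half_pow_le_seven {b : ℝ} (hb : 0 < b) (hb1 : b ≤ 1) {t : ℕ}
    (ht : b * t ≤ 2 + b) : (1 + b / 2) ^ t ≤ 7 := by
  have h1 : (1 + b / 2) ^ t ≤ exp (b * t / 2) := by
    have h2 : 1 + b / 2 ≤ exp (b / 2) := by linarith [add_one_le_exp (b / 2)]
    refine (pow_le_pow_left₀ (by linarith) h2 t).trans (le_of_eq ?_)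
    rw [← exp_nat_mul]
    congr 1
    ring
  have h2 : exp (b * t / 2) ≤ exp 1 * exp (1 / 2) := by
    rw [← exp_add]
    exact exp_le_exp.2 (by linarith)
  have h3 := exp_one_lt_d9
  have h4 : exp (1 / 2) * exp (1 / 2) = exp 1 := by
    rw [← exp_add]
    norm_num
  have h5 : exp (1 / 2) ≤ 2 := by nlinarith [exp_pos (1 / 2 : ℝ)]
  nlinarith [exp_pos (1 : ℝ)]

end Estimates

namespace Sandpile

noncomputable section

variable {V : Type*} [Fintype V] [DecidableEq V]

open Real

/-! ### Hitting probabilities along linear pieces -/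

theorem one_le_exp_mul {c C h : ℝ} (h0 : 0 ≤ h) (h1 : 1 ≤ c * h) (hc : 0 ≤ c) (hC : log c ≤ C) :
    1 ≤ exp C * h := by
  have hc0 : 0 < c := by
    rcases hc.eq_or_lt with rfl | h
    · norm_num at h1
    · exact h
  exact h1.trans (mul_le_mul_of_nonneg_right ((log_le_iff_le_exp hc0).1 hC) h0)

theorem two_le_size (S : Sandpile V) : 2 ≤ S.size := by
  obtain ⟨b, _⟩ := S.exists_sink
  have := S.eta_add_two_le b
  omega

/-- Hitting probabilities of `z` are comparable, up to the factor `Z`, on balls inside `S`. -/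
structure HarnackBound (S : Sandpile V) (z : V) (Z : ℝ) : Prop where
  near : ∀ v, 2 ≤ S.eta v → z ∈ S.ball v (S.eta v) → 1 ≤ Z * S.size * S.hit z v
  far : ∀ v w, 2 ≤ S.eta v → z ∉ S.ball v (S.eta v) →
    S.graph.dist v w + S.eta v / 2 ≤ S.eta v → S.hit z w ≤ 2 * Z * S.hit z v

/-- One hop along a walk ending at `z`. -/
theorem hit_hop (S : Sandpile V) {z : V} {Z : ℝ} (hS : S.HarnackBound z Z) {a : V}
    (P : S.graph.Walk a z) {j : ℕ} (hj : j ≤ P.length) {g : ℝ} (hg : 1 < g)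
    (hgη : g ≤ S.eta (P.getVert j)) :
    1 ≤ Z * S.size * S.hit z (P.getVert j) ∨ (g + j ≤ P.length ∧
      ∃ d : ℕ, 1 ≤ d ∧ j + d ≤ P.length ∧ 1 / 2 * g ≤ d ∧
        S.hit z (P.getVert (j + d)) ≤ 2 * Z * S.hit z (P.getVert j)) := by
  have h2 : 2 ≤ S.eta (P.getVert j) := by
    have : (1 : ℝ) < S.eta (P.getVert j) := by linarith
    exact_mod_cast this
  by_cases hz : z ∈ S.ball (P.getVert j) (S.eta (P.getVert j))
  · exact Or.inl (hS.near _ h2 hz)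
  · right
    have h3 : S.eta (P.getVert j) + j < P.length := by
      have h4 := S.dist_getVert_le P hj
      rw [P.getVert_length] at h4
      rw [mem_ball] at hz
      omega
    -- The hop is half of `η` rounded up, so the ball of radius `η / 2` about the new point stays
    -- inside the old ball.
    refine ⟨?_, S.eta (P.getVert j) - S.eta (P.getVert j) / 2, by omega, by omega, ?_, ?_⟩
    · have : (S.eta (P.getVert j) : ℝ) + j < P.length := by exact_mod_cast h3
      linarith
    · have : S.eta (P.getVert j) ≤ 2 * (S.eta (P.getVert j) - S.eta (P.getVert j) / 2) := by omega
      have : (S.eta (P.getVert j) : ℝ) ≤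
          2 * (S.eta (P.getVert j) - S.eta (P.getVert j) / 2 : ℕ) := by exact_mod_cast this
      linarith
    · refine hS.far _ _ h2 hz ?_
      have := S.dist_getVert_le P (Nat.le_add_right j
        (S.eta (P.getVert j) - S.eta (P.getVert j) / 2))
      omega

/-- Single steps until the profile exceeds `1`, then hops. The powers of `Z` are paid for by `m + 1
≤ T`, everything else by `ascending_cost_le`. -/
theorem one_le_exp_mul_hit_of_ascending (S : Sandpile V) {z : V} {Δ Z : ℝ}
    (hΔ : ∀ v, (S.deg v : ℝ) ≤ Δ) (hZ : 1 ≤ Z) (hS : S.HarnackBound z Z) {a : V}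
    (P : S.graph.Walk a z) {b g₀ : ℝ} (hb : 0 < b)
    (hb1 : b ≤ 1) (hg₀ : -1 ≤ g₀) (hg : ∀ j : ℕ, j ≤ P.length → g₀ + b * j ≤ S.eta (P.getVert j))
    (hΔ3 : 3 ≤ Δ) (hn : (7 : ℝ) ≤ S.size) :
    1 ≤ exp (log ((Δ + 1) * Z) * (log S.size / log (1 + b / 2))) * S.hit z a := by
  set n := (S.size : ℝ) with hn'
  set T := log n / log (1 + b / 2) with hT
  have hX : log ((Δ + 1) * Z) = log (Δ + 1) + log Z := log_mul (by linarith) (by linarith)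
  have hZ0 : 0 ≤ log Z := log_nonneg hZ
  have hT0 : 0 ≤ T := div_nonneg (log_nonneg (by linarith)) (log_nonneg (by linarith))
  have hηz : (S.eta (P.getVert P.length) : ℝ) ≤ n - 2 := by
    have : ((S.eta (P.getVert P.length) : ℝ)) + 2 ≤ n := by
      rw [hn']; exact_mod_cast S.eta_add_two_le (P.getVert P.length)
    linarith
  have hgL := (hg P.length le_rfl).trans hηz
  by_cases hex : ∃ t, t ≤ P.length ∧ 1 < g₀ + b * (t : ℕ)
  · classical
    set t := Nat.find hex with ht
    obtain ⟨htL, hgt⟩ := Nat.find_spec hex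
    rw [← ht] at htL hgt
    obtain ⟨m, h1, h2, h3⟩ := exists_ascending_chain (L := P.length) (g := fun j => g₀ + b * j)
      (q := fun j => S.hit z (P.getVert j)) (b := b) (θ := 1 / 2) (gs := 1) (N := n - 2)
      (κ := 1 + b) (Y := 2 * Z) (F := Z * n) hb.le (by norm_num) (by linarith) (by linarith)
      (by positivity) (fun j d => by push_cast; ring)
      (fun j hj hgj => by
        rcases S.hit_hop hS P hj hgj (hg j hj) with h | ⟨h, h'⟩
        · exact Or.inl h
        -- A hop happens only while `z` is farther than `g` along the walk, so the profile must
        -- still rise by `b * g`, and it may not exceed `n - 2`.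
        · refine Or.inr ⟨?_, h'⟩
          nlinarith) t htL hgt
    set g := g₀ + b * t with hgdef
    have hpre := S.hit_getVert_le hΔ z P 0 t (by omega)
    simp only [zero_add, SimpleGraph.Walk.getVert_zero] at hpre
    have htg : 1 ≤ t → g ≤ 1 + b := by
      intro ht1
      have := Nat.find_min hex (m := t - 1) (by omega)
      push Not at this
      have := this (by omega)
      rw [Nat.cast_sub ht1] at this
      push_cast at this
      linarith
    have hcost := ascending_cost_le (t := t) (m := m) hb hb1 hΔ3 hn hgt (by linarith) htg (by
      intro hm
      have := h2 hm
      rwa [show b * (1 / 2) = b / 2 by ring] at this)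
    have hmT : ((m + 1 : ℕ) : ℝ) ≤ T := by
      refine natCast_le_log_div hb ?_
      rcases Nat.lt_or_ge m 2 with hm | hm
      · have h4 : (1 + b / 2) ^ (m + 1) ≤ (1 + b / 2) ^ 2 :=
          pow_le_pow_right₀ (by linarith) (by omega)
        nlinarith
      · obtain ⟨k, rfl⟩ : ∃ k, m = k + 2 := ⟨m - 2, by omega⟩
        have h4 := h3 hm
        rw [show b * (1 / 2) = b / 2 by ring, Nat.add_sub_cancel] at h4
        have h5 : (1 + b / 2) ^ 3 ≤ (1 + b) * (g + b) := by
          nlinarith [pow_pos hb 2, pow_pos hb 3]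
        calc (1 + b / 2) ^ (k + 2 + 1) = (1 + b / 2) ^ k * (1 + b / 2) ^ 3 := by ring
          _ ≤ (1 + b / 2) ^ k * ((1 + b) * (g + b)) :=
              mul_le_mul_of_nonneg_left h5 (by positivity)
          _ = (1 + b) * (1 + b / 2) ^ k * (g + b) := by ring
          _ ≤ n := by linarith
    push_cast at hmT
    refine one_le_exp_mul (c := Z * n * (2 * Z) ^ m * Δ ^ t) (S.hit_nonneg z a) ?_
      (by positivity) ?_
    · calc (1 : ℝ) ≤ Z * n * (2 * Z) ^ m * S.hit z (P.getVert t) := h1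
        _ ≤ Z * n * (2 * Z) ^ m * (Δ ^ t * S.hit z a) :=
            mul_le_mul_of_nonneg_left hpre (by positivity)
        _ = _ := by ring
    · rw [log_mul (by positivity) (by positivity), log_mul (by positivity) (by positivity),
        log_mul (by positivity) (by positivity), log_pow, log_pow,
        log_mul (by positivity) (by positivity), hX]
      have h6 := mul_le_mul_of_nonneg_right hmT hZ0
      linarith only [h6, hcost]
  · push Not at hex
    have hL := hex P.length le_rfl
    have h1 := S.one_le_pow_mul_hit hΔ P
    refine one_le_exp_mul (S.hit_nonneg z a) h1 (by positivity) ?_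
    rw [log_pow, hX]
    have h2 : (P.length : ℝ) ≤ T := natCast_le_log_div hb
      ((one_add_half_pow_le_seven hb hb1 (by linarith)).trans hn)
    have h3 : log Δ ≤ log (Δ + 1) + log Z := by
      have := log_le_log (by linarith) (show Δ ≤ Δ + 1 by linarith)
      linarith
    rw [mul_comm]
    exact mul_le_mul h3 h2 (by positivity) (h3.trans' (log_nonneg (by linarith)))

/-- Here the hops come first. Either a ball captures `z` on the way, or the profile falls to `1` and
at most `3 / b` single steps remain. -/
theorem one_le_exp_mul_hit_of_descending (S : Sandpile V) {z : V} {Δ Z : ℝ}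
    (hΔ : ∀ v, (S.deg v : ℝ) ≤ Δ) (hZ : 1 ≤ Z) (hS : S.HarnackBound z Z) {a : V}
    (P : S.graph.Walk a z) {b g₀ : ℝ} (hb : 0 < b)
    (hb1 : b ≤ 1) (hg₀ : g₀ ≤ S.size - 2)
    (hg : ∀ j : ℕ, j ≤ P.length → g₀ - b * j ≤ S.eta (P.getVert j))
    (hgL : -2 ≤ g₀ - b * P.length)
    (hΔ3 : 3 ≤ Δ) (hn : (7 : ℝ) ≤ S.size) (hbn : 1 / 2 ≤ b ∨ (9 : ℝ) ≤ S.size) :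
    1 ≤ exp (log ((Δ + 1) * Z) * (log S.size / log (1 + b / 2))) * S.hit z a := by
  set n := (S.size : ℝ) with hn'
  set T := log n / log (1 + b / 2) with hT
  have hX : log ((Δ + 1) * Z) = log (Δ + 1) + log Z := log_mul (by linarith) (by linarith)
  have hZ0 : 0 ≤ log Z := log_nonneg hZ
  have hT0 : 0 ≤ T := div_nonneg (log_nonneg (by linarith)) (log_nonneg (by linarith))
  have hTZ : 0 ≤ T * log Z := mul_nonneg hT0 hZ0
  by_cases h0 : g₀ ≤ 1
  · have h1 := S.one_le_pow_mul_hit hΔ P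
    refine one_le_exp_mul (S.hit_nonneg z a) h1 (by positivity) ?_
    have h2 := descending_cost_le (t := P.length) (m := 0) hb hb1 hΔ3 hn hbn (by linarith)
      (by rw [pow_zero]; linarith)
    rw [log_pow, hX]
    push_cast at h2
    linarith only [h2, hTZ]
  push Not at h0
  obtain ⟨m, h⟩ := exists_descending_chain (L := P.length) (g := fun j => g₀ - b * j)
    (q := fun j => S.hit z (P.getVert j)) (b := b) (θ := 1 / 2) (gs := 1) (Y := 2 * Z)
    (F := Z * n) hb.le (by linarith) le_rfl (by linarith) (by positivity)
    (fun j d => by push_cast; ring)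
    (fun j hj hgj => (S.hit_hop hS P hj hgj (hg j hj)).imp id And.right)
    0 (by omega) (by simpa using h0)
  simp only [Nat.cast_zero, mul_zero, sub_zero, SimpleGraph.Walk.getVert_zero] at h
  rcases h with ⟨h1, h2⟩ | ⟨hm, h2, i, -, hi, hgi, h3⟩
  · have hmT : ((m + 1 : ℕ) : ℝ) ≤ T := natCast_le_log_div hb
      ((one_add_half_pow_le hb hb1 (by linarith) (h2.trans hg₀)).trans (by linarith))
    push_cast at hmT
    refine one_le_exp_mul (S.hit_nonneg z a) h1 (by positivity) ?_
    have hcost := trigger_cost_le hb hb1 hΔ3 (by linarith) hmT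
    rw [log_mul (by positivity) (by positivity), log_mul (by positivity) (by positivity), log_pow,
      log_mul (by positivity) (by positivity), hX]
    have h6 := mul_le_mul_of_nonneg_right hmT hZ0
    linarith only [h6, hcost]
  · have hm' := one_add_half_pow_le hb hb1 (by linarith) (h2.trans hg₀)
    rw [Nat.sub_add_cancel hm] at hm'
    have hmT : (m : ℝ) ≤ T := natCast_le_log_div hb (hm'.trans (by linarith))
    have hend := S.hit_getVert_le hΔ z P i (P.length - i) (by omega)
    rw [Nat.add_sub_cancel' hi, P.getVert_length, hit_self] at hend
    have hcost := descending_cost_le (t := P.length - i) (m := m) hb hb1 hΔ3 hn hbn (by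
      rw [Nat.cast_sub hi]
      linarith) hm'
    refine one_le_exp_mul (c := Δ ^ (P.length - i) * (2 * Z) ^ m) (S.hit_nonneg z a) ?_
      (by positivity) ?_
    · calc (1 : ℝ) ≤ Δ ^ (P.length - i) * S.hit z (P.getVert i) := hend
        _ ≤ Δ ^ (P.length - i) * ((2 * Z) ^ m * S.hit z a) :=
            mul_le_mul_of_nonneg_left h3 (by positivity)
        _ = _ := by ring
    · rw [log_mul (by positivity) (by positivity), log_pow, log_pow,
        log_mul (by positivity) (by positivity), hX]
      have h6 := mul_le_mul_of_nonneg_right hmT hZ0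
      linarith only [h6, hcost]

/-- The hitting probability of the end of a linear piece from its beginning. -/
theorem one_le_exp_mul_hit_of_linearAlong (S : Sandpile V) {z : V} {Δ Z : ℝ}
    (hΔ : ∀ v, (S.deg v : ℝ) ≤ Δ) (hZ : 1 ≤ Z) (hS : S.HarnackBound z Z)
    {β : ℝ} (hβ : 0 < β) {a : V} (P : S.graph.Walk a z)
    (hP : S.LinearAlong β P) :
    1 ≤ exp (log ((Δ + 1) * Z) * (log S.size / log (1 + β / 2))) * S.hit z a := by
  obtain ⟨al, au, b, hal, hau, hβb, hb1, h⟩ := hP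
  have hn2 := S.two_le_size
  have hn2' : (2 : ℝ) ≤ S.size := by exact_mod_cast hn2
  have hΔ1 : 1 ≤ Δ := (S.one_le_deg a).trans (hΔ a)
  have hX2 : 2 ≤ (Δ + 1) * Z := by nlinarith
  have hX0 : 0 ≤ log ((Δ + 1) * Z) := log_nonneg (by linarith)
  have hb0 : 0 < |b| := hβ.trans_le hβb
  rw [abs_le] at hal hau
  suffices hs : 1 ≤ exp (log ((Δ + 1) * Z) * (log S.size / log (1 + |b| / 2))) * S.hit z a by
    refine hs.trans (mul_le_mul_of_nonneg_right (exp_le_exp.2 ?_) (S.hit_nonneg z a))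
    refine mul_le_mul_of_nonneg_left ?_ hX0
    refine div_le_div_of_nonneg_left (log_nonneg (by linarith)) (log_pos (by linarith)) ?_
    exact log_le_log (by linarith) (by linarith)
  by_cases hdeg : ∀ v, S.deg v ≤ 2
  · refine one_le_exp_mul (S.hit_nonneg z a) (S.one_le_size_mul_hit hdeg a z) (by positivity) ?_
    have h1 : log (1 + |b| / 2) ≤ log ((Δ + 1) * Z) := log_le_log (by linarith) (by linarith)
    rw [mul_div_assoc', le_div_iff₀ (log_pos (by linarith)), mul_comm]
    exact mul_le_mul_of_nonneg_right h1 (log_nonneg (by linarith))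
  push Not at hdeg
  have hΔ3 : 3 ≤ Δ := by
    obtain ⟨v, hv⟩ := hdeg
    refine le_trans ?_ (hΔ v)
    exact_mod_cast hv
  by_cases hsmall : S.size ≤ 6 ∨ (S.size ≤ 8 ∧ |b| < 1 / 2)
  · obtain ⟨Q, -, hQ⟩ := S.exists_isPath_length_lt a z
    refine one_le_exp_mul (S.hit_nonneg z a) (S.one_le_pow_mul_hit hΔ Q) (by positivity) ?_
    have h1 : (Q.length : ℝ) ≤ log S.size / log (1 + |b| / 2) := by
      have h2 := natCast_le_log_div hb0 (one_add_half_pow_le_of_small hb0 hb1 hn2 hsmall)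
      refine le_trans ?_ h2
      exact_mod_cast (by omega : Q.length ≤ S.size - 2)
    have h3 : log Δ ≤ log ((Δ + 1) * Z) := log_le_log (by linarith) (by nlinarith)
    rw [log_pow, mul_comm]
    exact mul_le_mul h3 h1 (by positivity) hX0
  have hn7 : (7 : ℝ) ≤ S.size := by exact_mod_cast (by omega : 7 ≤ S.size)
  have hbn : 1 / 2 ≤ |b| ∨ (9 : ℝ) ≤ S.size := by
    by_cases h9 : 9 ≤ S.size
    · exact Or.inr (by exact_mod_cast h9)
    · left
      by_contra hb2
      exact hsmall (Or.inr ⟨by omega, by linarith⟩)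
  rcases le_total 0 b with hb | hb
  · rw [abs_of_nonneg hb] at *
    exact S.one_le_exp_mul_hit_of_ascending hΔ hZ hS P (g₀ := al + S.eta a) hb0 hb1
      (by linarith [Nat.cast_nonneg (α := ℝ) (S.eta a)]) (fun j hj => (h j hj).1) hΔ3 hn7
  · rw [abs_of_nonpos hb] at *
    -- At `j = 0` the lower bound forces `al ≤ 0`, so the profile starts no higher than `η a`; the
    -- upper bound at the end keeps it above `-2` there.
    have h0 := (h 0 (by omega)).1
    have hL := (h P.length le_rfl).2
    have hη : (S.eta a : ℝ) + 2 ≤ S.size := by exact_mod_cast S.eta_add_two_le a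
    simp only [SimpleGraph.Walk.getVert_zero, Nat.cast_zero, mul_zero, add_zero] at h0
    refine S.one_le_exp_mul_hit_of_descending hΔ hZ hS P (g₀ := al + S.eta a) hb0 hb1
      (by linarith) (fun j hj => ?_) ?_ hΔ3 hn7 hbn
    · linarith [(h j hj).1]
    · linarith [Nat.cast_nonneg (α := ℝ) (S.eta (P.getVert P.length))]

end

end Sandpile

/-! ### Linear pieces through ball masses, without the mean value property. -/

theorem one_add_mul_pow_le_descentHeight {b θ : ℝ} (hb : 0 ≤ b) (hθ : 0 ≤ θ) (hθ1 : θ ≤ 1)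
    (hbθ : b * θ < 1) (m : ℕ) : (1 + b * θ) ^ m ≤ descentHeight b θ m := by
  have h0 : 0 ≤ b * θ := mul_nonneg hb hθ
  have hpos : 0 < 1 - b * θ := by linarith
  cases m with
  | zero => simp [descentHeight]
  | succ m =>
    simp only [descentHeight]
    rw [le_div_iff₀ (by positivity), pow_succ', mul_assoc, ← mul_pow]
    have h1 : ((1 + b * θ) * (1 - b * θ)) ^ m ≤ 1 := by
      refine pow_le_one₀ ?_ ?_
      · exact mul_nonneg (by linarith) hpos.le
      · nlinarith
    have h2 : b * θ ≤ b := mul_le_of_le_one_right hb hθ1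
    nlinarith

namespace Sandpile

noncomputable section

variable {V : Type*} [Fintype V] [DecidableEq V]

open Real

/-- The mass of the hitting probability of `z` is comparable, up to the factor `H`, on balls
inside `S`, and controlled by its value at the centre up to the factor `M`. -/
structure MassBound (S : Sandpile V) (z : V) (H M : ℝ) : Prop where
  near : ∀ v, 4 ≤ S.eta v → z ∈ S.ball v (4 * (S.eta v / 4)) → 1 ≤ H * S.quarterMass z v
  far : ∀ v w, 4 ≤ S.eta v → z ∉ S.ball v (4 * (S.eta v / 4)) →
    S.graph.dist v w ≤ 2 * (S.eta v / 4) → S.quarterMass z w ≤ 2 * H * S.quarterMass z v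
  start : ∀ v, 4 ≤ S.eta v → S.quarterMass z v ≤ M * S.hit z v ∨ 1 ≤ M * S.hit z v

/-- One hop of the mass of the hitting probability along a walk ending at `z`. -/
theorem quarterMass_hop (S : Sandpile V) {z : V} {H M : ℝ} (hS : S.MassBound z H M) {a : V}
    (P : S.graph.Walk a z) {j : ℕ} (hj : j ≤ P.length) {g : ℝ}
    (hg : 3 < g) (hgη : g ≤ S.eta (P.getVert j)) :
    1 ≤ H * S.quarterMass z (P.getVert j) ∨
      ∃ d : ℕ, 1 ≤ d ∧ j + d ≤ P.length ∧ 1 / 4 * g ≤ d ∧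
        S.quarterMass z (P.getVert (j + d)) ≤ 2 * H * S.quarterMass z (P.getVert j) := by
  have h4 : 4 ≤ S.eta (P.getVert j) := by
    have : (3 : ℝ) < S.eta (P.getVert j) := by linarith
    exact_mod_cast this
  by_cases hz : z ∈ S.ball (P.getVert j) (4 * (S.eta (P.getVert j) / 4))
  · exact Or.inl (hS.near _ h4 hz)
  · right
    have h3 : 4 * (S.eta (P.getVert j) / 4) + j < P.length := by
      have h4 := S.dist_getVert_le P hj
      rw [P.getVert_length] at h4
      rw [mem_ball] at hz
      omega
    -- With `r = η / 4 ≥ 1`, `η ≤ 4 * r + 3 ≤ 8 * r`, so a hop of `2 * r` covers a quarter of `η`.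
    refine ⟨2 * (S.eta (P.getVert j) / 4), by omega, by omega, ?_, ?_⟩
    · have : S.eta (P.getVert j) ≤ 4 * (2 * (S.eta (P.getVert j) / 4)) := by omega
      have : (S.eta (P.getVert j) : ℝ) ≤ 4 * (2 * (S.eta (P.getVert j) / 4) : ℕ) := by
        exact_mod_cast this
      linarith
    · refine hS.far _ _ h4 hz ?_
      have := S.dist_getVert_le P (Nat.le_add_right j (2 * (S.eta (P.getVert j) / 4)))
      omega

/-- Along an increasing profile, few steps and logarithmically many hops suffice. -/
theorem exists_one_le_mul_hit_of_ascending (S : Sandpile V) {z : V} {D H M : ℝ}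
    (hD : ∀ v, (S.deg v : ℝ) ≤ D) (hH : 1 ≤ H) (hM : 1 ≤ M) (hS : S.MassBound z H M) {a : V}
    (P : S.graph.Walk a z) {b g₀ : ℝ} (hb : 0 < b)
    (hb1 : b ≤ 1) (hg₀ : -1 ≤ g₀)
    (hg : ∀ j : ℕ, j ≤ P.length → g₀ + b * j ≤ S.eta (P.getVert j)) :
    ∃ t m : ℕ, b * t ≤ 5 ∧ (1 + b / 4) ^ (m - 1) ≤ S.size ∧
      1 ≤ D ^ t * (M * (H * (2 * H) ^ m)) * S.hit z a := by
  have hD1 : 1 ≤ D := (S.one_le_deg a).trans (hD a)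
  have hn2 : (2 : ℝ) ≤ S.size := by exact_mod_cast S.two_le_size
  by_cases hex : ∃ t, t ≤ P.length ∧ 3 < g₀ + b * (t : ℕ)
  · classical
    set t := Nat.find hex with ht
    obtain ⟨htL, hgt⟩ := Nat.find_spec hex
    rw [← ht] at htL hgt
    have hη : ∀ v, (S.eta v : ℝ) ≤ S.size := fun v => by
      exact_mod_cast (Nat.le_of_add_right_le (S.eta_add_two_le v))
    obtain ⟨m, h1, h2, -⟩ := exists_ascending_chain (L := P.length) (g := fun j => g₀ + b * j)
      (q := fun j => S.quarterMass z (P.getVert j)) (b := b) (θ := 1 / 4) (gs := 3)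
      (N := S.size) (κ := 1) (Y := 2 * H) (F := H) hb.le (by norm_num) zero_le_one (by linarith)
      (by linarith) (fun j d => by push_cast; ring)
      (fun j hj hgj => (S.quarterMass_hop hS P hj hgj (hg j hj)).imp id fun h =>
        ⟨by rw [one_mul]; exact (hg j hj).trans (hη _), h⟩) t htL hgt
    have hpre := S.hit_getVert_le hD z P 0 t (by omega)
    simp only [zero_add, SimpleGraph.Walk.getVert_zero] at hpre
    have hbt : b * t ≤ 5 := by
      rcases Nat.eq_zero_or_pos t with h0 | ht1
      · rw [h0]; norm_num
      have := Nat.find_min hex (m := t - 1) (by omega)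
      push Not at this
      have := this (by omega)
      rw [Nat.cast_sub ht1] at this
      push_cast at this
      linarith
    have h4 : 4 ≤ S.eta (P.getVert t) := by
      have : (3 : ℝ) < S.eta (P.getVert t) := by linarith [hg t htL]
      exact_mod_cast this
    have hY : 1 ≤ H * (2 * H) ^ m :=
      one_le_mul_of_one_le_of_one_le hH (one_le_pow₀ (by linarith))
    have hstart' : 1 ≤ M * (H * (2 * H) ^ m) * S.hit z (P.getVert t) := by
      rcases hS.start _ h4 with h | h
      · calc (1 : ℝ) ≤ H * (2 * H) ^ m * S.quarterMass z (P.getVert t) := h1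
          _ ≤ H * (2 * H) ^ m * (M * S.hit z (P.getVert t)) :=
              mul_le_mul_of_nonneg_left h (by positivity)
          _ = _ := by ring
      · nlinarith
    refine ⟨t, m, hbt, ?_, ?_⟩
    · rcases Nat.eq_zero_or_pos m with rfl | hm
      · rw [Nat.zero_sub, pow_zero]; linarith
      · have h5 := h2 hm
        rw [show b * (1 / 4) = b / 4 by ring, one_mul] at h5
        have h6 : 0 < (1 + b / 4) ^ (m - 1) := by positivity
        nlinarith
    · calc (1 : ℝ) ≤ M * (H * (2 * H) ^ m) * S.hit z (P.getVert t) := hstart'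
        _ ≤ M * (H * (2 * H) ^ m) * (D ^ t * S.hit z a) :=
            mul_le_mul_of_nonneg_left hpre (by positivity)
        _ = _ := by ring
  · push Not at hex
    have hL := hex P.length le_rfl
    refine ⟨P.length, 0, by linarith, by rw [Nat.zero_sub, pow_zero]; linarith, ?_⟩
    have h1 := S.one_le_pow_mul_hit hD P
    have h2 : 1 ≤ M * (H * (2 * H) ^ 0) := by
      rw [pow_zero, mul_one]
      exact one_le_mul_of_one_le_of_one_le hM hH
    rw [mul_right_comm]
    exact one_le_mul_of_one_le_of_one_le h1 h2

/-- Along a decreasing profile, few steps and logarithmically many hops suffice. -/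
theorem exists_one_le_mul_hit_of_descending (S : Sandpile V) {z : V} {D H M : ℝ}
    (hD : ∀ v, (S.deg v : ℝ) ≤ D) (hH : 1 ≤ H) (hM : 1 ≤ M) (hS : S.MassBound z H M) {a : V}
    (P : S.graph.Walk a z) {b g₀ : ℝ} (hb : 0 < b)
    (hb1 : b ≤ 1) (hg₀ : g₀ ≤ S.eta a)
    (hg : ∀ j : ℕ, j ≤ P.length → g₀ - b * j ≤ S.eta (P.getVert j))
    (hgL : -2 ≤ g₀ - b * P.length) :
    ∃ t m : ℕ, b * t ≤ 5 ∧ (1 + b / 4) ^ (m - 1) ≤ S.size ∧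
      1 ≤ D ^ t * (M * (H * (2 * H) ^ m)) * S.hit z a := by
  have hD1 : 1 ≤ D := (S.one_le_deg a).trans (hD a)
  have hn2 : (2 : ℝ) ≤ S.size := by exact_mod_cast S.two_le_size
  have hη : (S.eta a : ℝ) ≤ S.size := by
    exact_mod_cast (Nat.le_of_add_right_le (S.eta_add_two_le a))
  by_cases h0 : g₀ ≤ 3
  · refine ⟨P.length, 0, by linarith, by rw [Nat.zero_sub, pow_zero]; linarith, ?_⟩
    have h1 := S.one_le_pow_mul_hit hD P
    have h2 : 1 ≤ M * (H * (2 * H) ^ 0) := by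
      rw [pow_zero, mul_one]
      exact one_le_mul_of_one_le_of_one_le hM hH
    rw [mul_right_comm]
    exact one_le_mul_of_one_le_of_one_le h1 h2
  push Not at h0
  obtain ⟨m, h⟩ := exists_descending_chain (L := P.length) (g := fun j => g₀ - b * j)
    (q := fun j => S.quarterMass z (P.getVert j)) (b := b) (θ := 1 / 4) (gs := 3) (Y := 2 * H)
    (F := H) hb.le (by linarith) (by norm_num) (by linarith) (by linarith)
    (fun j d => by push_cast; ring)
    (fun j hj hgj => S.quarterMass_hop hS P hj hgj (hg j hj))
    0 (by omega) (by simpa using h0)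
  simp only [Nat.cast_zero, mul_zero, sub_zero, SimpleGraph.Walk.getVert_zero] at h
  have h4 : 4 ≤ S.eta a := by
    have : (3 : ℝ) < S.eta a := by linarith
    exact_mod_cast this
  have hY : 1 ≤ H * (2 * H) ^ m :=
    one_le_mul_of_one_le_of_one_le hH (one_le_pow₀ (by linarith))
  have hp := S.hit_nonneg z a
  have hmono : ∀ k, (1 + b / 4) ^ k ≤ descentHeight b (1 / 4) k := by
    intro k
    have := one_add_mul_pow_le_descentHeight hb.le (θ := 1 / 4) (by norm_num) (by norm_num)
      (by linarith) k
    rwa [show b * (1 / 4) = b / 4 by ring] at this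
  have hq0 := S.quarterMass_nonneg z a
  rcases h with ⟨h1, h2⟩ | ⟨hm, h2, i, -, hi, hgi, h3⟩
  · refine ⟨0, m, by norm_num, ?_, ?_⟩
    · refine (pow_le_pow_right₀ (by linarith) (Nat.sub_le m 1)).trans ?_
      exact (hmono m).trans (by linarith)
    · rw [pow_zero, one_mul]
      rcases hS.start _ h4 with h | h
      · calc (1 : ℝ) ≤ H * (2 * H) ^ m * S.quarterMass z a := h1
          _ ≤ H * (2 * H) ^ m * (M * S.hit z a) := mul_le_mul_of_nonneg_left h (by positivity)
          _ = _ := by ring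
      · nlinarith
  · have hend := S.hit_getVert_le hD z P i (P.length - i) (by omega)
    rw [Nat.add_sub_cancel' hi, P.getVert_length, hit_self] at hend
    refine ⟨P.length - i, m, ?_, (hmono _).trans (by linarith), ?_⟩
    · rw [Nat.cast_sub hi]
      linarith
    · have hDt : 1 ≤ D ^ (P.length - i) := one_le_pow₀ hD1
      rcases hS.start _ h4 with h | h
      · have h5 : S.hit z (P.getVert i) ≤ (2 * H) ^ m * (M * S.hit z a) :=
          (S.hit_le_quarterMass z _).trans
            (h3.trans (mul_le_mul_of_nonneg_left h (by positivity)))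
        have h6 : (2 * H) ^ m * (M * S.hit z a) ≤ H * ((2 * H) ^ m * (M * S.hit z a)) :=
          le_mul_of_one_le_left (by positivity) hH
        calc (1 : ℝ) ≤ D ^ (P.length - i) * S.hit z (P.getVert i) := hend
          _ ≤ D ^ (P.length - i) * (H * ((2 * H) ^ m * (M * S.hit z a))) :=
              mul_le_mul_of_nonneg_left (h5.trans h6) (by positivity)
          _ = _ := by ring
      · calc (1 : ℝ) ≤ D ^ (P.length - i) * (H * (2 * H) ^ m) * (M * S.hit z a) :=
              one_le_mul_of_one_le_of_one_le (one_le_mul_of_one_le_of_one_le hDt hY) h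
          _ = _ := by ring

theorem one_le_exp_mul_hit_of_linearAlong_of_mass (S : Sandpile V) {z : V} {D H M : ℝ}
    (hD : ∀ v, (S.deg v : ℝ) ≤ D) (hH : 1 ≤ H) (hM : 1 ≤ M) (hS : S.MassBound z H M)
    {β : ℝ} (hβ : 0 < β) {a : V} (P : S.graph.Walk a z) (hP : S.LinearAlong β P) :
    1 ≤ exp (5 / β * log D + (log M + (log H + (1 + log S.size / log (1 + β / 4)) *
      log (2 * H)))) * S.hit z a := by
  have hD1 : 1 ≤ D := (S.one_le_deg a).trans (hD a)
  have hn2 : (2 : ℝ) ≤ S.size := by exact_mod_cast S.two_le_size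
  obtain ⟨t, m, ht, hm, h⟩ : ∃ t m : ℕ, β * t ≤ 5 ∧ (1 + β / 4) ^ (m - 1) ≤ S.size ∧
      1 ≤ D ^ t * (M * (H * (2 * H) ^ m)) * S.hit z a := by
    obtain ⟨al, au, b, hal, hau, hβb, hb1, h⟩ := hP
    have hb0 : 0 < |b| := hβ.trans_le hβb
    rw [abs_le] at hal hau
    suffices hs : ∃ t m : ℕ, |b| * t ≤ 5 ∧ (1 + |b| / 4) ^ (m - 1) ≤ S.size ∧
        1 ≤ D ^ t * (M * (H * (2 * H) ^ m)) * S.hit z a by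
      obtain ⟨t, m, h1, h2, h3⟩ := hs
      refine ⟨t, m, (mul_le_mul_of_nonneg_right hβb (Nat.cast_nonneg t)).trans h1, ?_, h3⟩
      exact (pow_le_pow_left₀ (by linarith) (by linarith) _).trans h2
    rcases le_total 0 b with hb | hb
    · rw [abs_of_nonneg hb] at *
      exact S.exists_one_le_mul_hit_of_ascending hD hH hM hS P
        (g₀ := al + S.eta a) hb0 hb1 (by linarith [Nat.cast_nonneg (α := ℝ) (S.eta a)])
        (fun j hj => (h j hj).1)
    · rw [abs_of_nonpos hb] at *
      have h0 := (h 0 (by omega)).1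
      have hL := (h P.length le_rfl).2
      simp only [SimpleGraph.Walk.getVert_zero, Nat.cast_zero, mul_zero, add_zero] at h0
      refine S.exists_one_le_mul_hit_of_descending hD hH hM hS P
        (g₀ := al + S.eta a) hb0 hb1 (by linarith) (fun j hj => ?_) ?_
      · linarith [(h j hj).1]
      · linarith [Nat.cast_nonneg (α := ℝ) (S.eta (P.getVert P.length))]
  refine one_le_exp_mul (S.hit_nonneg z a) h (by positivity) ?_
  rw [log_mul (by positivity) (by positivity), log_mul (by positivity) (by positivity),
    log_mul (by positivity) (by positivity), log_pow, log_pow]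
  have h1 : (t : ℝ) ≤ 5 / β := by
    rw [le_div_iff₀ hβ]
    linarith
  have h2 : (m : ℝ) ≤ 1 + log S.size / log (1 + β / 4) := by
    have h3 : ((m - 1 : ℕ) : ℝ) ≤ log S.size / log (1 + β / 4) := by
      rw [le_div_iff₀ (log_pos (by linarith)), ← log_pow]
      exact log_le_log (by positivity) hm
    have h4 : (m : ℝ) ≤ 1 + (m - 1 : ℕ) := by exact_mod_cast (by omega : m ≤ 1 + (m - 1))
    linarith
  have h5 := mul_le_mul_of_nonneg_right h1 (log_nonneg hD1)
  have h6 := mul_le_mul_of_nonneg_right h2 (log_nonneg (show 1 ≤ 2 * H by linarith))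
  linarith

/-! ### Central paths -/

theorem one_le_exp_mul_hit_of_length_le (S : Sandpile V) {Δ C : ℝ} (hΔ : ∀ v, (S.deg v : ℝ) ≤ Δ)
    {a z : V} (P : S.graph.Walk a z) (hP : (P.length : ℝ) ≤ C) :
    1 ≤ exp (C * log Δ) * S.hit z a := by
  have hΔ1 : 1 ≤ Δ := (S.one_le_deg a).trans (hΔ a)
  refine one_le_exp_mul (S.hit_nonneg z a) (S.one_le_pow_mul_hit hΔ P) (by positivity) ?_
  rw [log_pow]
  exact mul_le_mul_of_nonneg_right hP (log_nonneg hΔ1)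

/-- Each piece is estimated towards its own endpoint, and the exponents add up by `hit_mul_hit_le`.
-/
theorem one_le_exp_mul_hit_of_isCentral (S : Sandpile V) {β l W : ℝ}
    (h : ∀ (a z : V) (P : S.graph.Walk a z), S.CentralPiece β l P → 1 ≤ exp W * S.hit z a)
    (k : ℕ) {u w : V} (P : S.graph.Walk u w) (hP : S.IsCentral β l k P) :
    1 ≤ exp (k * W) * S.hit w u := by
  induction k generalizing u with
  | zero =>
    obtain rfl := SimpleGraph.Walk.eq_of_length_eq_zero hP
    simp [hit_self]
  | succ k ih =>
    obtain ⟨m, P₁, P₂, -, h1, h2⟩ := hP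
    calc (1 : ℝ) ≤ exp W * S.hit m u * (exp (k * W) * S.hit w m) :=
          one_le_mul_of_one_le_of_one_le (h u m P₁ h1) (ih P₂ h2)
      _ = exp (W + k * W) * (S.hit m u * S.hit w m) := by rw [exp_add]; ring
      _ ≤ exp (W + k * W) * S.hit w u :=
          mul_le_mul_of_nonneg_left (S.hit_mul_hit_le w m u) (exp_pos _).le
      _ = _ := by push_cast; ring_nf

end

end Sandpile

/-! ### From hitting probabilities to the two bounds for families. -/

namespace SandpileFamily

open Real

theorem gHat_eq {β : ℝ} (hβ : 0 < β) (hβ1 : β ≤ 1) : gHat β = 1 + β / 2 := by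
  unfold gHat
  refine min_eq_left ?_
  rw [le_inv_comm₀ (by linarith) (by linarith), inv_eq_one_div, le_div_iff₀ (by linarith)]
  nlinarith

variable {ι : Type*} {V : ι → Type*} [∀ i, Fintype (V i)] [∀ i, DecidableEq (V i)]

theorem polynomialTransience_of_hit {S : ∀ i, Sandpile (V i)} {Δ A B : ℝ}
    (hΔ : DegreeBounded S Δ)
    (h : ∀ i (u w : V i), 1 ≤ exp (A + B * log (S i).size) * (S i).hit w u) :
    PolynomialTransience S := by
  refine ⟨Polynomial.C (⌈Δ⌉₊ * ⌈exp A⌉₊) * Polynomial.X ^ (⌈B⌉₊ + 1), fun i u =>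
    ⟨_, le_rfl, fun w => ?_⟩⟩
  have hn : (1 : ℝ) ≤ (S i).size := by exact_mod_cast (S i).two_le_size.trans' one_le_two
  have hΔ1 : 1 ≤ Δ := ((S i).one_le_deg u).trans (hΔ i u)
  have hp := (S i).hit_nonneg w u
  refine (S i).topples_of_lt (hΔ i) ?_
  simp only [Polynomial.eval_mul, Polynomial.eval_C, Polynomial.eval_pow, Polynomial.eval_X]
  push_cast
  have hpoly : exp (A + B * log (S i).size) ≤ ⌈exp A⌉₊ * ((S i).size : ℝ) ^ ⌈B⌉₊ := by
    rw [exp_add]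
    refine mul_le_mul (Nat.le_ceil _) ?_ (exp_pos _).le (Nat.cast_nonneg _)
    rw [← rpow_natCast, rpow_def_of_pos (by linarith), mul_comm (log _)]
    exact exp_le_exp.2 (mul_le_mul_of_nonneg_right (Nat.le_ceil _) (log_nonneg hn))
  have h1 := (h i u w).trans (mul_le_mul_of_nonneg_right hpoly hp)
  have h2 : (Δ - 1) * Fintype.card (V i) < Δ * (S i).size := by
    have h3 : (Fintype.card (V i) : ℝ) + 1 = (S i).size := by
      unfold Sandpile.size
      push_cast
      rfl
    have h4 : (0 : ℝ) ≤ Fintype.card (V i) := Nat.cast_nonneg _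
    nlinarith
  calc (Δ - 1) * Fintype.card (V i) < Δ * (S i).size := h2
    _ ≤ ⌈Δ⌉₊ * (S i).size := mul_le_mul_of_nonneg_right (Nat.le_ceil _) (by linarith)
    _ ≤ ⌈Δ⌉₊ * (S i).size * (⌈exp A⌉₊ * ((S i).size : ℝ) ^ ⌈B⌉₊ * (S i).hit w u) :=
        le_mul_of_one_le_right (by positivity) h1
    _ = _ := by ring

/-- Epicentre propagation: polynomially many particles at any site topple everything. -/
theorem polynomialTransience {S : ∀ i, Sandpile (V i)} {Δ Cσ : ℝ} {f : ℝ → ℝ} {k : ℕ} {l β : ℝ}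
    (hl : 0 ≤ l) (hβ : 0 < β) (hΔ : DegreeBounded S Δ) (hLC : HighLocalConductance S Cσ)
    (hOP : OverlappingPotentials S f) (hNI : NonemptyInterior S k l β) :
    PolynomialTransience S := by
  set C := max Cσ 1 with hC
  set H := max (f 4) 1 with hH
  have hC1 : 1 ≤ C := le_max_right _ _
  have hH1 : 1 ≤ H := le_max_right _ _
  -- No sign of `Cσ` or `f 4` is assumed here, so both are first raised to at least `1`.
  have hLC' : HighLocalConductance S C := by
    intro i v r hr hrη
    obtain ⟨N, hN, h⟩ := hLC i v r hr hrη
    exact ⟨N, hN.trans (mul_le_mul_of_nonneg_right (le_max_left _ _) ((S i).vol_nonneg v r)), h⟩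
  set A := 5 / β * log Δ + log (2 * C * Δ) + log H + log (2 * H) with hA
  set B := 1 + log (2 * H) / log (1 + β / 4) + l * log Δ with hB
  refine polynomialTransience_of_hit (Δ := Δ) (A := k * A) (B := k * B) hΔ fun i u w => ?_
  have hΔ1 : 1 ≤ Δ := ((S i).one_le_deg u).trans (hΔ i u)
  have hn : (1 : ℝ) ≤ (S i).size := by exact_mod_cast (S i).two_le_size.trans' one_le_two
  have hlogn := log_nonneg hn
  have hlogΔ := log_nonneg hΔ1
  have hlogH := log_nonneg hH1
  have hlogH2 := log_nonneg (show 1 ≤ 2 * H by linarith)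
  have hCΔ : 1 ≤ 2 * C * Δ := by nlinarith
  have hlogC := log_nonneg hCΔ
  have hlogβ : 0 ≤ log (1 + β / 4) := log_nonneg (by linarith)
  have hM1 : 1 ≤ 2 * (C * (Δ * (S i).size)) := by
    have := one_le_mul_of_one_le_of_one_le hCΔ hn
    linarith
  have hpiece : ∀ (a z : V i) (P : (S i).graph.Walk a z), (S i).CentralPiece β l P →
      1 ≤ exp (A + B * log (S i).size) * (S i).hit z a := by
    rintro a z P (hP | hP)
    · have h1 := (S i).one_le_exp_mul_hit_of_linearAlong_of_mass (hΔ i) hH1 hM1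
        ⟨fun v hv hz => (S i).one_le_mul_quarterMass (hOP i) (le_max_left _ _) hv hz,
          fun v x hv hz hx => (S i).quarterMass_le (hOP i) (le_max_left _ _) hv hz hx,
          fun v hv => by
            rcases (S i).quarterMass_le_of_conductance (hLC' i) (hΔ i) (by linarith) (z := z) hv
              with h | h
            · exact Or.inl h
            · right
              have := (S i).hit_nonneg z v
              linarith⟩ hβ P hP
      refine h1.trans (mul_le_mul_of_nonneg_right (exp_le_exp.2 ?_) ((S i).hit_nonneg z a))
      have hM : log (2 * (C * (Δ * (S i).size))) = log (2 * C * Δ) + log (S i).size := by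
        rw [← log_mul (by positivity) (by positivity)]
        congr 1
        ring
      rw [hM, hA, hB]
      have h2 : 0 ≤ l * log Δ * log (S i).size := by positivity
      have h3 : log (S i).size / log (1 + β / 4) * log (2 * H) =
          log (2 * H) / log (1 + β / 4) * log (S i).size := by ring
      linarith
    · refine ((S i).one_le_exp_mul_hit_of_length_le (hΔ i) P hP).trans
        (mul_le_mul_of_nonneg_right (exp_le_exp.2 ?_) ((S i).hit_nonneg z a))
      have h2 : 0 ≤ A := by positivity
      have h3 : 0 ≤ (1 + log (2 * H) / log (1 + β / 4)) * log (S i).size := by positivity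
      rw [hB]
      linarith
  obtain ⟨P, hP⟩ := hNI i u w
  have := (S i).one_le_exp_mul_hit_of_isCentral hpiece k P hP
  convert this using 3
  ring

/-- The explicit bound for the transience class. -/
theorem tcl_le {S : ∀ i, Sandpile (V i)} {Δ Cσ Ch δ α l β : ℝ} {k : ℕ}
    (hl : 0 ≤ l) (hβ : 0 < β) (hβ1 : β ≤ 1) (hCσ : 1 ≤ Cσ) (hCh : 0 < Ch) (hCh1 : Ch ≤ 1)
    (hδ : 0 < δ) (hδΔ : δ ≤ Δ) (hα : 0 ≤ α) (hΔ : DegreeBounded S Δ)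
    (hLC : HighLocalConductance S Cσ) (hNI : NonemptyInterior S k l β)
    (hMV : MeanValue S Ch) (hV : VolumeGrowth S α δ Δ) (i : ι) :
    BddAbove (S i).transientCounts ∧ ((S i).tcl : ℝ) ≤ Cσ * Δ * ((S i).size : ℝ) ^
      ((k : ℝ) + (2 * l + 1) * (k : ℝ) *
        logb (gHat β) (Cσ / Ch * (Δ * (Δ + 1) / δ) * (3 : ℝ) ^ α)) := by
  set Z := Cσ / Ch * (Δ / δ) * (3 : ℝ) ^ α with hZdef
  have hXZ : Cσ / Ch * (Δ * (Δ + 1) / δ) * (3 : ℝ) ^ α = (Δ + 1) * Z := by rw [hZdef]; ring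
  have h3α : 1 ≤ (3 : ℝ) ^ α := one_le_rpow (by norm_num) hα
  have hCC : 1 ≤ Cσ / Ch := (one_le_div hCh).2 (by linarith)
  have hδδ : 1 ≤ Δ / δ := (one_le_div hδ).2 hδΔ
  have hZ3 : 1 ≤ Δ / δ * (3 : ℝ) ^ α := one_le_mul_of_one_le_of_one_le hδδ h3α
  have hZC : Cσ / Ch ≤ Z := by
    rw [hZdef, mul_assoc]
    exact le_mul_of_one_le_right (by linarith) hZ3
  have hZ : 1 ≤ Z := hCC.trans hZC
  rw [hXZ, gHat_eq hβ hβ1]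
  obtain ⟨v₀, -⟩ := (S i).exists_sink
  have hΔ1 : 1 ≤ Δ := ((S i).one_le_deg v₀).trans (hΔ i v₀)
  have hn2 : (2 : ℝ) ≤ (S i).size := by exact_mod_cast (S i).two_le_size
  set n := ((S i).size : ℝ) with hn
  have hlogn : 0 ≤ log n := log_nonneg (by linarith)
  have hX : log Δ ≤ log ((Δ + 1) * Z) := log_le_log (by linarith) (by nlinarith)
  have hlogΔ : 0 ≤ log Δ := log_nonneg hΔ1
  have hℓ0 : 0 < log (1 + β / 2) := log_pos (by linarith)
  have hℓ1 : log (1 + β / 2) ≤ 1 := by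
    have := log_le_sub_one_of_pos (show 0 < 1 + β / 2 by linarith)
    linarith
  have hT : log n ≤ log n / log (1 + β / 2) := by
    rw [le_div_iff₀ hℓ0]
    exact mul_le_of_le_one_right hlogn hℓ1
  set W := log ((Δ + 1) * Z) * (log n / log (1 + β / 2)) with hW
  have hW0 : 0 ≤ W := mul_nonneg (by linarith) (by linarith)
  have hpiece : ∀ (a z : V i) (P : (S i).graph.Walk a z), (S i).CentralPiece β l P →
      1 ≤ exp ((2 * l + 1) * W) * (S i).hit z a := by
    rintro a z P (hP | hP)
    · refine ((S i).one_le_exp_mul_hit_of_linearAlong (hΔ i) hZ ⟨?_, ?_⟩ hβ P hP).trans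
        (mul_le_mul_of_nonneg_right (exp_le_exp.2 ?_) ((S i).hit_nonneg z a))
      · intro v hv hz
        refine ((S i).one_le_size_mul_hit_of_mem_ball (hLC i) (hMV i) hCσ hCh (by omega) le_rfl
          hz).trans ?_
        refine mul_le_mul_of_nonneg_right ?_ ((S i).hit_nonneg z v)
        exact mul_le_mul_of_nonneg_right hZC (by linarith)
      · intro v w hv hz hw
        exact (S i).hit_le_two_mul_hit (hLC i) (hMV i) hCσ hCh hδ (by linarith) hα (hV i) hv hz hw
      · exact le_mul_of_one_le_left hW0 (by linarith)
    · refine ((S i).one_le_exp_mul_hit_of_length_le (hΔ i) P hP).trans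
        (mul_le_mul_of_nonneg_right (exp_le_exp.2 ?_) ((S i).hit_nonneg z a))
      have h1 : log Δ * log n ≤ W := mul_le_mul hX hT hlogn (by linarith)
      have h2 : l * W ≤ (2 * l + 1) * W := mul_le_mul_of_nonneg_right (by linarith) hW0
      have h3 := mul_le_mul_of_nonneg_left h1 hl
      linarith
  have hhit : ∀ u w : V i, exp (-(k * ((2 * l + 1) * W))) ≤ (S i).hit w u := by
    intro u w
    obtain ⟨P, hP⟩ := hNI i u w
    have h1 := (S i).one_le_exp_mul_hit_of_isCentral hpiece k P hP
    rw [exp_neg, inv_eq_one_div, div_le_iff₀ (exp_pos _)]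
    linarith
  -- The summand `k` of the exponent absorbs the number of sites. For `k = 0` all central paths are
  -- trivial and there is at most one site.
  have hcard : (Fintype.card (V i) : ℝ) ≤ n ^ (k : ℝ) := by
    rw [rpow_natCast]
    rcases Nat.eq_zero_or_pos k with rfl | hk
    · have : Subsingleton (V i) := ⟨fun a b => by
        obtain ⟨P, hP⟩ := hNI i a b
        exact SimpleGraph.Walk.eq_of_length_eq_zero hP⟩
      rw [pow_zero]
      exact_mod_cast Fintype.card_le_one_iff_subsingleton.2 this
    · refine le_trans ?_ (le_self_pow₀ (by linarith) hk.ne')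
      rw [hn]
      exact_mod_cast Nat.le_succ (Fintype.card (V i))
  have hpow : n ^ ((k : ℝ) + (2 * l + 1) * (k : ℝ) * logb (1 + β / 2) ((Δ + 1) * Z)) =
      n ^ (k : ℝ) * exp (k * ((2 * l + 1) * W)) := by
    rw [rpow_add (by linarith)]
    congr 1
    rw [rpow_def_of_pos (by linarith), logb, hW]
    congr 1
    ring
  rw [hpow]
  have hbound : ∀ N ∈ (S i).transientCounts,
      (N : ℝ) ≤ Cσ * Δ * (n ^ (k : ℝ) * exp (k * ((2 * l + 1) * W))) := by
    intro N hN
    have h1 := (S i).mul_le_of_mem_transientCounts (hΔ i) hhit hN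
    rw [exp_neg, ← div_eq_mul_inv, div_le_iff₀ (exp_pos _)] at h1
    refine h1.trans ?_
    rw [← mul_assoc (Cσ * Δ)]
    refine mul_le_mul_of_nonneg_right ?_ (exp_pos _).le
    refine mul_le_mul ?_ hcard (Nat.cast_nonneg _) (by positivity)
    nlinarith
  have hbdd : BddAbove (S i).transientCounts :=
    ⟨⌊Cσ * Δ * (n ^ (k : ℝ) * exp (k * ((2 * l + 1) * W)))⌋₊,
      fun N hN => Nat.le_floor (hbound N hN)⟩
  refine ⟨hbdd, ?_⟩
  -- The supremum in `ℕ` is `0` for the empty set and is attained for a nonempty bounded one.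
  rcases (S i).transientCounts.eq_empty_or_nonempty with h | h
  · have : (S i).tcl = 0 := by simp [Sandpile.tcl, h]
    rw [this, Nat.cast_zero]
    positivity
  · exact hbound _ (Nat.sSup_mem h hbdd)

end SandpileFamily

theorem mainTheorem1 {ι : Type*} {V : ι → Type*} [∀ i, Fintype (V i)] [∀ i, DecidableEq (V i)]
    (S : ∀ i, Sandpile (V i)) (Δ Cσ : ℝ) (f : ℝ → ℝ) (k : ℕ) (l β : ℝ)
    (hl : 0 ≤ l) (hβ : 0 < β) (hβ1 : β ≤ 1)
    (hΔ : SandpileFamily.DegreeBounded S Δ)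
    (hLC : SandpileFamily.HighLocalConductance S Cσ)
    (hOP : SandpileFamily.OverlappingPotentials S f)
    (hNI : SandpileFamily.NonemptyInterior S k l β) :
    SandpileFamily.PolynomialTransience S ∧
    ∀ Ch δ α : ℝ, 1 ≤ Cσ → 0 < Ch → Ch ≤ 1 → 0 < δ → δ ≤ Δ → 0 ≤ α →
      SandpileFamily.MeanValue S Ch → SandpileFamily.VolumeGrowth S α δ Δ →
      ∀ i, BddAbove (S i).transientCounts ∧
        ((S i).tcl : ℝ) ≤ Cσ * Δ * ((S i).size : ℝ) ^
          ((k : ℝ) + (2 * l + 1) * (k : ℝ) *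
            Real.logb (SandpileFamily.gHat β)
              (Cσ / Ch * (Δ * (Δ + 1) / δ) * (3 : ℝ) ^ α)) := by
  exact ⟨SandpileFamily.polynomialTransience hl hβ hΔ hLC hOP hNI,
    fun Ch δ α hCσ hCh hCh1 hδ hδΔ hα hMV hV i =>
      SandpileFamily.tcl_le hl hβ hβ1 hCσ hCh hCh1 hδ hδΔ hα hΔ hLC hNI hMV hV i⟩
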